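/- Let $\mathcal H$ be a separable infinite-dimensional complex Hilbert space, let $S$ be a bounded positive invertible operator on $\mathcal H$, and let $\mathbf c=(c_i)_{i\in\mathbb N}$ be a bounded sequence of non-negative real numbers with $\sum_{i}c_i=\infty$. The pair $(S,\mathbf c)$ is called frame admissible if there is a sequence $(f_i)_{i\in\mathbb N}$ in $\mathcal H$ which is a frame (there are constants $A,B>0$ with $A\|x\|^2\le\sum_i|\langle x,f_i\rangle|^2\le B\|x\|^2$ for all $x\in\mathcal H$), whose frame operator is $S$ (that is, $Sx=\sum_i\langle x,f_i\rangle f_i$ for all $x\in\mathcal H$), and which satisfies $\|f_i\|^2=c_i$ for all $i$. For $k\ge 1$ put $$U_k(S)=\sup\{\operatorname{tr}(SP): P \text{ an orthogonal projection of rank } k\},\qquad U_k(\mathbf c)=\sup_{F\subset\mathbb N,\ |F|=k}\ \sum_{i\in F}c_i .$$ Let $\|S\|_e=\inf\{\|S+K\|:K\text{ compact}\}$ be the essential norm of $S$, and let $P_2(S)=E\big([\|S\|_e,\|S\|]\big)$, where $E$ is the spectral measure of $S$. **Theorem 5.4.** Assume that one of the following two conditions holds. 1. (a) $P_2(S)$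 has infinite rank, (b) $U_k(S)\ge U_k(\mathbf c)$ for every $k\ge1$, and (c) $\|S\|_e>\limsup_{i\to\infty}c_i$. 2. (a) $P_2(S)$ has finite rank $r\ge 0$, (b) $U_k(S)\ge U_k(\mathbf c)$ for $1\le k\le r$, (c) $U_k(S)>U_k(\mathbf c)$ for every $k>r$, and (d) $\|S\|_e>\limsup_{i\to\infty}c_i$. Then the pair $(S,\mathbf c)$ is frame admissible. -/

import Mathlib

open Filter Topology MeasureTheory
open scoped CompactlySupported InnerProductSpace

noncomputable section

namespace FrameAdm

variable {H : Type*} [NormedAddCommGroup H] [InnerProductSpace ℂ H]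

/-- The essential norm `‖T‖ₑ = inf {‖T + K‖ : K compact}`, that is, the norm of the class of `T`
in the Calkin algebra. -/
def essNorm (T : H →L[ℂ] H) : ℝ :=
  ⨅ K : {K : H →L[ℂ] H // IsCompactOperator K}, ‖T + (K : H →L[ℂ] H)‖

/-- The trace of an operator of finite rank: the trace of its restriction to its
(finite-dimensional) range. -/
def finTrace (T : H →L[ℂ] H) : ℂ :=
  LinearMap.trace ℂ (LinearMap.range (T : H →ₗ[ℂ] H))
    ((T : H →ₗ[ℂ] H).rangeRestrict ∘ₗ (LinearMap.range (T : H →ₗ[ℂ] H)).subtype)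

/-- The rank of an operator, as a cardinal number: the dimension of its range. -/
def opRank (T : H →L[ℂ] H) : Cardinal :=
  Module.rank ℂ (LinearMap.range (T : H →ₗ[ℂ] H))

/-- `U_k(S) = sup {tr (S P) : P an orthogonal projection of rank k}` for a hermitian operator `S`
(for which `tr (S P)` is real). -/
def opU [CompleteSpace H] (k : ℕ) (S : H →L[ℂ] H) : ℝ :=
  sSup {t : ℝ | ∃ P : H →L[ℂ] H, IsStarProjection P ∧ opRank P = (k : Cardinal) ∧
    t = (finTrace (S ∘L P)).re}

/-- `U_k(c) = sup {∑_{i ∈ F} c_i : |F| = k}` for a bounded real sequence `c`. -/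
def seqU (k : ℕ) (c : ℕ → ℝ) : ℝ :=
  sSup {t : ℝ | ∃ F : Finset ℕ, F.card = k ∧ t = ∑ i ∈ F, c i}

section Spectral

variable [CompleteSpace H]

/-- The positive linear functional `f ↦ ⟪x, f(S) x⟫` on compactly supported continuous functions
on the line, where `f(S)` is given by the continuous functional calculus of the self-adjoint
operator `S`. -/
def spectralFunctional (S : H →L[ℂ] H) (x : H) : C_c(ℝ, ℝ) →ₚ[ℝ] ℝ :=
  PositiveLinearMap.mk₀
    { toFun := fun f => (⟪x, cfc (f : ℝ → ℝ) S x⟫_ℂ).re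
      map_add' := by
        intro f g
        have h : cfc ((f + g : C_c(ℝ, ℝ)) : ℝ → ℝ) S = cfc (f : ℝ → ℝ) S + cfc (g : ℝ → ℝ) S := by
          rw [← cfc_add S (f : ℝ → ℝ) (g : ℝ → ℝ) f.continuous.continuousOn
            g.continuous.continuousOn]
          rfl
        rw [h, add_apply, inner_add_right, Complex.add_re]
      map_smul' := by
        intro r f
        have h : cfc ((r • f : C_c(ℝ, ℝ)) : ℝ → ℝ) S = r • cfc (f : ℝ → ℝ) S := by
          rw [← cfc_smul r (f : ℝ → ℝ) S f.continuous.continuousOn]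
          rfl
        rw [h, smul_apply, inner_smul_right_eq_smul, Complex.smul_re]
        rfl }
    (by
      intro f hf
      have h : 0 ≤ cfc (f : ℝ → ℝ) S := cfc_nonneg fun t _ => hf t
      have h' := (ContinuousLinearMap.nonneg_iff_isPositive _).1 h
      exact h'.re_inner_nonneg_right x)

/-- The scalar spectral measure `μ_x` of the self-adjoint operator `S` at the vector `x`: the
measure on the line that represents the functional `f ↦ ⟪x, f(S) x⟫`. -/
def scalarSpectralMeasure (S : H →L[ℂ] H) (x : H) : Measure ℝ :=
  RealRMK.rieszMeasure (spectralFunctional S x)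

/-- The defining property of the scalar spectral measure: `∫ f dμ_x = ⟪x, f(S) x⟫`. -/
theorem integral_scalarSpectralMeasure (S : H →L[ℂ] H) (x : H) (f : C_c(ℝ, ℝ)) :
    ∫ t, f t ∂(scalarSpectralMeasure S x) = (⟪x, cfc (f : ℝ → ℝ) S x⟫_ℂ).re :=
  RealRMK.integral_rieszMeasure (spectralFunctional S x) f

/-- The spectral measure `E` of the self-adjoint operator `S` at the Borel set `B`. Since
`μ_x(A) = ⟪x, E(A) x⟫ = ‖E(A) x‖²`, the projection `E(B)` is the orthogonal projection onto the
closed subspace of the vectors `x` whose spectral measure `μ_x` is carried by `B`. (Taking the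
closed span changes nothing: these vectors form a closed subspace already.) -/
def spectralProjection (S : H →L[ℂ] H) (B : Set ℝ) : H →L[ℂ] H :=
  (Submodule.topologicalClosure
    (Submodule.span ℂ {x : H | scalarSpectralMeasure S x Bᶜ = 0})).starProjection

/-- The spectral projection `P₂(S) = E[‖S‖ₑ, ‖S‖]`. -/
def P2 (S : H →L[ℂ] H) : H →L[ℂ] H :=
  spectralProjection S (Set.Icc (essNorm S) ‖S‖)

end Spectral

/-- `f` is a frame: `A ‖x‖² ≤ ∑ₖ |⟨x, f_k⟩|² ≤ B ‖x‖²` for some constants `A, B > 0`. -/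
def IsFrame (f : ℕ → H) : Prop :=
  ∃ A B : ℝ, 0 < A ∧ 0 < B ∧ ∀ x : H, Summable (fun k => ‖⟪f k, x⟫_ℂ‖ ^ 2) ∧
    A * ‖x‖ ^ 2 ≤ ∑' k, ‖⟪f k, x⟫_ℂ‖ ^ 2 ∧ ∑' k, ‖⟪f k, x⟫_ℂ‖ ^ 2 ≤ B * ‖x‖ ^ 2

/-- `S` is the frame operator of `f`: `S x = ∑ₖ ⟨x, f_k⟩ f_k` for all `x`. (The inner product of
Mathlib is linear in the second variable.) -/
def HasFrameOperator (f : ℕ → H) (S : H →L[ℂ] H) : Prop :=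
  ∀ x : H, HasSum (fun k => ⟪f k, x⟫_ℂ • f k) (S x)

/-- The pair `(S, c)` is frame admissible: some frame has frame operator `S` and squared norms
`c`. -/
def FrameAdmissible (S : H →L[ℂ] H) (c : ℕ → ℝ) : Prop :=
  ∃ f : ℕ → H, IsFrame f ∧ HasFrameOperator f S ∧ ∀ k, ‖f k‖ ^ 2 = c k

end FrameAdm

end

namespace FrameAdm

/-! ### Plane rotations and finite majorization. -/

section Rotation

variable {H : Type*} [NormedAddCommGroup H] [InnerProductSpace ℂ H]

/-! It suffices to find vectors with the prescribed norms and `∑ |⟨f i, x⟩| ^ 2 = ⟨x, S x⟩` for all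
`x`, that is, to write `S` as a sum of rank one operators `f i ⊗ f i` with traces `c i`
(`frameAdmissible_of_hasSum`). The basic tool is that a plane rotation of two vectors preserves the
sum of their rank one operators and moves the norms continuously between the two.

Fix `b` with `limsup c < b < ‖S‖ₑ`. Only finitely many `c i` are not below `b`. These are realized
first, below `S`: one finds `f i` with `∑ f i ⊗ f i ≤ S` over this finite set. To this end top
eigenvectors of `S` are split off one at a time, as long as the supremum of the quadratic form on
the unit vectors orthogonal to the previous ones is attained, which it is whenever it exceeds the
essential norm (`IsTopFlag.extend`). If enough eigenvectors appear, Ky Fan's bound turns `U_k(c) ≤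
U_k(S)` into domination of the partial sums of `c` by those of the eigenvalues. If the process stops
after `n` steps, then `P₂(S)` has rank at most `n`, so the second condition holds with `r ≤ n`, and
for `k > n` the strict inequality leaves room to continue the eigenvalues by a constant slightly
below `‖S‖ₑ`, which the form exceeds on an orthonormal sequence. In both cases finite majorization
(`exists_of_partial_sums_le`), applied to the images of these orthonormal vectors under the square
root of `S`, gives the `f i`.

The remainder `T` is positive, and as only finitely many vectors were removed, its form still
exceeds some `g > b` on an orthonormal sequence. Hence `T` is a sum of rank one operators,
infinitely many of them of trace at least `g`, and a greedy algorithm redistributes them to the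
small `c i` (`exists_redistribution_of_family`). The divergence of `∑ c i` forces every vector to be
used, and the carried remainder tends weakly to zero because each rotation contracts it by a fixed
factor. -/

theorem norm_sq_smul_add_smul (a b : H) (C D : ℝ) :
    ‖(C : ℂ) • a + (D : ℂ) • b‖ ^ 2
      = C ^ 2 * ‖a‖ ^ 2 + 2 * (C * D) * (⟪a, b⟫_ℂ).re + D ^ 2 * ‖b‖ ^ 2 := by
  rw [@norm_add_sq ℂ]
  simp only [norm_smul, inner_smul_left, inner_smul_right, Complex.conj_ofReal, mul_pow,
    Complex.norm_real, Real.norm_eq_abs, sq_abs]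
  have : RCLike.re ((C : ℂ) * ((D : ℂ) * ⟪a, b⟫_ℂ)) = C * D * (⟪a, b⟫_ℂ).re := by
    simp [mul_assoc]
  rw [mul_left_comm, mul_left_comm (D : ℂ)] at *
  rw [this]
  ring

/-- A plane rotation preserves the sum of the squared norms. -/
theorem norm_sq_rotation (a b : H) {C D : ℝ} (h : C ^ 2 + D ^ 2 = 1) :
    ‖(C : ℂ) • a + (D : ℂ) • b‖ ^ 2 + ‖((-D : ℝ) : ℂ) • a + (C : ℂ) • b‖ ^ 2
      = ‖a‖ ^ 2 + ‖b‖ ^ 2 := by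
  rw [norm_sq_smul_add_smul, norm_sq_smul_add_smul]
  linear_combination (‖a‖ ^ 2 + ‖b‖ ^ 2) * h

/-- Two vectors `p`, `h` can be rotated so that the first one gets any prescribed squared norm
`c` between those of `p` and `h`; the second one then contains little of `p`. -/
theorem exists_rotation (p h : H) {c : ℝ} (hp : ‖p‖ ^ 2 ≤ c) (hh : c ≤ ‖h‖ ^ 2) :
    ∃ f p' : H, ‖f‖ ^ 2 = c ∧ ‖p'‖ ^ 2 = ‖p‖ ^ 2 + ‖h‖ ^ 2 - c ∧
      (∀ x : H, ‖⟪f, x⟫_ℂ‖ ^ 2 + ‖⟪p', x⟫_ℂ‖ ^ 2 = ‖⟪p, x⟫_ℂ‖ ^ 2 + ‖⟪h, x⟫_ℂ‖ ^ 2) ∧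
      ∃ s : ℝ, 0 ≤ s ∧ s ≤ 1 ∧ s ^ 2 * ‖h‖ ^ 2 ≤ c ∧
        ∀ x : H, ‖⟪p', x⟫_ℂ‖ ≤ s * ‖⟪p, x⟫_ℂ‖ + ‖⟪h, x⟫_ℂ‖ := by
  -- Changing the sign of `h` affects no conclusion. A nonnegative cross term is what bounds the
  -- weight `s = sin t` by `s ^ 2 * ‖h‖ ^ 2 ≤ c`.
  wlog hre : 0 ≤ (⟪p, h⟫_ℂ).re generalizing h
  · simpa using this (-h) (by simpa using hh) (by simp; linarith)
  have hcont : ContinuousOn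
      (fun t : ℝ => Real.cos t ^ 2 * ‖p‖ ^ 2 + 2 * (Real.cos t * Real.sin t) * (⟪p, h⟫_ℂ).re
        + Real.sin t ^ 2 * ‖h‖ ^ 2) (Set.Icc 0 (Real.pi / 2)) := by fun_prop
  obtain ⟨t, ht, hct⟩ := intermediate_value_Icc (by positivity) hcont
    (show c ∈ Set.Icc _ _ by simpa using ⟨hp, hh⟩)
  have hcos : 0 ≤ Real.cos t := Real.cos_nonneg_of_mem_Icc ⟨by linarith [ht.1, Real.pi_pos], ht.2⟩
  have hsin : 0 ≤ Real.sin t :=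
    Real.sin_nonneg_of_nonneg_of_le_pi ht.1 (by linarith [ht.2, Real.pi_pos])
  have h1 := Real.cos_sq_add_sin_sq t
  dsimp only at hct
  set C := Real.cos t
  set D := Real.sin t
  have hf : ‖(C : ℂ) • p + (D : ℂ) • h‖ ^ 2 = c := by rw [norm_sq_smul_add_smul, hct]
  have hin : ∀ (a b : ℝ) (x : H), ⟪(a : ℂ) • p + (b : ℂ) • h, x⟫_ℂ
      = (a : ℂ) • ⟪p, x⟫_ℂ + (b : ℂ) • ⟪h, x⟫_ℂ := by
    intro a b x
    rw [inner_add_left, inner_smul_left, inner_smul_left, Complex.conj_ofReal, Complex.conj_ofReal]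
    rfl
  refine ⟨(C : ℂ) • p + (D : ℂ) • h, ((-D : ℝ) : ℂ) • p + (C : ℂ) • h, hf, ?_, ?_, D, hsin,
    Real.sin_le_one t, ?_, ?_⟩
  · linarith [norm_sq_rotation p h h1]
  · intro x
    rw [hin, hin, norm_sq_rotation _ _ h1]
  · nlinarith [mul_nonneg (mul_nonneg hcos hsin) hre, mul_nonneg (sq_nonneg C) (sq_nonneg ‖p‖)]
  · intro x
    rw [hin]
    refine (norm_add_le _ _).trans ?_
    have hC : |C| ≤ 1 := Real.abs_cos_le_one t
    simp only [norm_smul, Complex.norm_real, norm_neg, Real.norm_eq_abs,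
      abs_of_nonneg hsin]
    nlinarith [norm_nonneg ⟪h, x⟫_ℂ]

/-- If `c` is decreasing and its partial sums are at most those of `‖h i‖ ^ 2`, then there are
vectors `f i` with squared norms `c i` and `∑ f i ⊗ f i ≤ ∑ h i ⊗ h i`. -/
theorem exists_of_partial_sums_le (N : ℕ) : ∀ (c : ℕ → ℝ) (h : ℕ → H), (∀ i, 0 ≤ c i) →
    (∀ i j, i ≤ j → j < N → c j ≤ c i) →
    (∀ k ≤ N, ∑ i ∈ Finset.range k, c i ≤ ∑ i ∈ Finset.range k, ‖h i‖ ^ 2) →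
    ∃ f : ℕ → H, (∀ i < N, ‖f i‖ ^ 2 = c i) ∧
      ∀ x : H, ∑ i ∈ Finset.range N, ‖⟪f i, x⟫_ℂ‖ ^ 2 ≤ ∑ i ∈ Finset.range N, ‖⟪h i, x⟫_ℂ‖ ^ 2 := by
  induction N with
  | zero => intro c h _ _ _; exact ⟨h, by simp, by simp⟩
  | succ N ih =>
    intro c h hc hanti hmaj
    by_cases hbig : ∀ i < N + 1, c 0 ≤ ‖h i‖ ^ 2
    -- Here each `h i` is long enough to be shortened on its own, by a rotation against the zero
    -- vector.
    · have : ∀ i, ∃ f : H, i < N + 1 → ‖f‖ ^ 2 = c i ∧ ∀ x, ‖⟪f, x⟫_ℂ‖ ^ 2 ≤ ‖⟪h i, x⟫_ℂ‖ ^ 2 := by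
        intro i
        by_cases hi : i < N + 1
        · obtain ⟨f, p', hf, -, hsum, -⟩ := exists_rotation (0 : H) (h i) (c := c i)
            (by simpa using hc i) ((hanti 0 i (Nat.zero_le _) hi).trans (hbig i hi))
          refine ⟨f, fun _ => ⟨hf, fun x => ?_⟩⟩
          have := hsum x
          simp only [inner_zero_left, norm_zero] at this
          nlinarith [sq_nonneg ‖⟪p', x⟫_ℂ‖]
        · exact ⟨0, fun h => absurd h hi⟩
      choose f hf using this
      exact ⟨f, fun i hi => (hf i hi).1, fun x => Finset.sum_le_sum fun i hi =>
        (hf i (Finset.mem_range.1 hi)).2 x⟩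
    · push Not at hbig
      classical
      obtain ⟨m, ⟨hmN, hm⟩, hmin⟩ : ∃ m, (m < N + 1 ∧ ‖h m‖ ^ 2 < c 0) ∧
          ∀ i < m, c 0 ≤ ‖h i‖ ^ 2 := by
        refine ⟨Nat.find hbig, Nat.find_spec hbig, fun i hi => ?_⟩
        have := Nat.find_min hbig hi
        push Not at this
        exact this (hi.trans (Nat.find_spec hbig).1)
      obtain ⟨j, rfl⟩ : ∃ j, m = j + 1 := by
        refine Nat.exists_eq_succ_of_ne_zero ?_
        rintro rfl
        have := hmaj 1 (by omega)
        simp at this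
        linarith
      obtain ⟨f₀, p', hf₀, hp', hsum, -⟩ := exists_rotation (h (j + 1)) (h j) hm.le
        (hmin j (by omega))
      -- The first short vector `h (j + 1)` and its long predecessor yield `f₀` of squared norm `c
      -- 0` and a leftover `p'`, which takes the place of both. Partial sums up to `j` stay large
      -- because all their terms are at least `c 0`; beyond `j` the rotation only lowers them by `c
      -- 0`.
      let h' : ℕ → H := fun i => if i < j then h i else if i = j then p' else h (i + 1)
      have hlt : ∀ i < j, h' i = h i := fun i hi => if_pos hi
      have hj : h' j = p' := by simp [h']
      have hgt : ∀ i, j < i → h' i = h (i + 1) := by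
        intro i hi
        simp [h', hi.ne', not_lt.2 hi.le]
      have key : ∀ G : H → ℝ, G f₀ + G p' = G (h (j + 1)) + G (h j) → ∀ k, j + 1 ≤ k →
          ∑ i ∈ Finset.range k, G (h' i) + G f₀ = ∑ i ∈ Finset.range (k + 1), G (h i) := by
        intro G hG k hk
        induction k, hk using Nat.le_induction with
        | base =>
          rw [Finset.sum_range_succ, Finset.sum_range_succ, Finset.sum_range_succ, hj,
            Finset.sum_congr rfl fun i hi => by rw [hlt i (Finset.mem_range.1 hi)]]
          linarith
        | succ k hk ihk =>
          rw [Finset.sum_range_succ, Finset.sum_range_succ _ (k + 1), ← ihk, hgt k hk]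
          ring
      have hc0 : ∀ k ≤ N, ∑ i ∈ Finset.range k, c (i + 1) ≤ ∑ i ∈ Finset.range k, ‖h' i‖ ^ 2 := by
        intro k hk
        rcases le_or_gt k j with hkj | hkj
        · refine Finset.sum_le_sum fun i hi => ?_
          have hi := Finset.mem_range.1 hi
          rw [hlt i (by omega)]
          exact (hanti 0 (i + 1) (by omega) (by omega)).trans (hmin i (by omega))
        · have h1 := key (fun v => ‖v‖ ^ 2) (by rw [hf₀, hp']; ring) k hkj
          have h2 := hmaj (k + 1) (by omega)
          rw [← h1, Finset.sum_range_succ', hf₀] at h2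
          linarith
      obtain ⟨f, hf, hfx⟩ := ih (fun i => c (i + 1)) h' (fun i => hc _)
        (fun i j hij hj => hanti _ _ (by omega) (by omega)) hc0
      refine ⟨fun i => Nat.casesOn i f₀ f, ?_, fun x => ?_⟩
      · rintro (_ | i) hi
        · exact hf₀
        · exact hf i (by omega)
      · rw [Finset.sum_range_succ', ← key (fun v => ‖⟪v, x⟫_ℂ‖ ^ 2) (hsum x) N (by omega)]
        exact add_le_add (hfx x) le_rfl

end Rotation

/-! ### Greedy redistribution of infinitely many rank one operators. -/

section

/-- A nonnegative sequence with `u (j + 1) ≤ t * u j + b j`, `t < 1` and `b` summable tends to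
zero. -/
theorem tendsto_zero_of_le_mul_add {u b : ℕ → ℝ} {t : ℝ} (ht : 0 ≤ t) (ht1 : t < 1)
    (hu : ∀ j, 0 ≤ u j) (hb : ∀ j, 0 ≤ b j) (hs : Summable b)
    (h : ∀ j, u (j + 1) ≤ t * u j + b j) : Tendsto u atTop (𝓝 0) := by
  -- Summing the recursion bounds the partial sums of `u`, so `u` is even summable.
  have hbound : ∀ n, (1 - t) * ∑ j ∈ Finset.range n, u j + t * u n ≤ u 0 + ∑' j, b j := by
    intro n
    have h1 : ∀ n, (1 - t) * ∑ j ∈ Finset.range n, u j + u n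
        ≤ u 0 + ∑ j ∈ Finset.range n, b j := by
      intro n
      induction n with
      | zero => simp
      | succ n ih =>
        rw [Finset.sum_range_succ, Finset.sum_range_succ]
        linarith [h n]
    have h2 := hs.sum_le_tsum (Finset.range n) fun j _ => hb j
    nlinarith [h1 n, hu n]
  refine (summable_of_sum_range_le (c := (u 0 + ∑' j, b j) / (1 - t)) hu
    fun n => ?_).tendsto_atTop_zero
  rw [le_div_iff₀ (by linarith)]
  nlinarith [hbound n, mul_nonneg ht (hu n)]

variable {H : Type*} [NormedAddCommGroup H] [InnerProductSpace ℂ H]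

/-- One step of the greedy algorithm: from the vector `p` and, if `p` is too short, also `h`, split
off a vector `f` of squared norm `c`. -/
theorem exists_greedy_step {b g : ℝ} (hbg : b < g) (hg : 0 < g) (p h : H) {c : ℝ} (hc : 0 ≤ c)
    (hcb : c ≤ b) (hh : g ≤ ‖h‖ ^ 2) :
    ∃ f p' : H, ∃ e : ℕ, ‖f‖ ^ 2 = c ∧ ((e = 0 ∧ c + ‖p'‖ ^ 2 = ‖p‖ ^ 2 ∧
        (∀ x : H, ‖⟪f, x⟫_ℂ‖ ^ 2 + ‖⟪p', x⟫_ℂ‖ ^ 2 = ‖⟪p, x⟫_ℂ‖ ^ 2)) ∨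
      (e = 1 ∧ c + ‖p'‖ ^ 2 = ‖p‖ ^ 2 + ‖h‖ ^ 2 ∧
        (∀ x : H, ‖⟪f, x⟫_ℂ‖ ^ 2 + ‖⟪p', x⟫_ℂ‖ ^ 2 = ‖⟪p, x⟫_ℂ‖ ^ 2 + ‖⟪h, x⟫_ℂ‖ ^ 2) ∧
        (∀ x : H, ‖⟪p', x⟫_ℂ‖ ^ 2 ≤ √(b / g) * ‖⟪p, x⟫_ℂ‖ ^ 2
          + (1 - √(b / g))⁻¹ * ‖⟪h, x⟫_ℂ‖ ^ 2))) := by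
  have hb : 0 ≤ b := hc.trans hcb
  rcases le_or_gt c (‖p‖ ^ 2) with hcp | hcp
  · obtain ⟨f, p', hf, hp', hsum, -⟩ := exists_rotation (0 : H) p (by simpa using hc) hcp
    refine ⟨f, p', 0, hf, Or.inl ⟨rfl, ?_, fun x => ?_⟩⟩
    · rw [hp']; simp
    · rw [hsum]; simp
  · obtain ⟨f, p', hf, hp', hsum, s, hs0, -, hs, hle⟩ := exists_rotation p h hcp.le
      (hcb.trans (hbg.le.trans hh))
    refine ⟨f, p', 1, hf, Or.inr ⟨rfl, by rw [hp']; ring, hsum, fun x => ?_⟩⟩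
    have hq1 : √(b / g) < 1 := by
      rw [Real.sqrt_lt' one_pos, one_pow, div_lt_one hg]
      exact hbg
    have hsq : s ≤ √(b / g) := by
      apply Real.le_sqrt_of_sq_le
      rw [le_div_iff₀ hg]
      nlinarith [sq_nonneg s]
    set q := √(b / g) with hq
    have hq0 : 0 ≤ q := Real.sqrt_nonneg _
    set A := ‖⟪p, x⟫_ℂ‖
    set B := ‖⟪h, x⟫_ℂ‖
    have hA : 0 ≤ A := norm_nonneg _
    have hB : 0 ≤ B := norm_nonneg _
    have h1 : ‖⟪p', x⟫_ℂ‖ ≤ q * A + B := (hle x).trans (by gcongr)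
    calc ‖⟪p', x⟫_ℂ‖ ^ 2 ≤ (q * A + B) ^ 2 := by gcongr
      -- Convexity of the square, with weights `q` at `A` and `1 - q` at `B / (1 - q)`.
      _ ≤ q * A ^ 2 + (1 - q)⁻¹ * B ^ 2 := by
        have h1q : 0 < 1 - q := by linarith
        have : q * A ^ 2 + (1 - q)⁻¹ * B ^ 2 - (q * A + B) ^ 2
            = q * ((1 - q) * A - B) ^ 2 * (1 - q)⁻¹ := by
          field_simp
          ring
        have : 0 ≤ q * ((1 - q) * A - B) ^ 2 * (1 - q)⁻¹ := by positivity
        linarith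

/-- If the `h j` are longer than all prescribed norms, whose squares have infinite sum, then
`p ⊗ p + ∑ h j ⊗ h j` can be written as `∑ f i ⊗ f i` with `‖f i‖ ^ 2 = c i`. -/
theorem exists_redistribution {b g : ℝ} (hbg : b < g) (p : H) (h : ℕ → H)
    (hh : ∀ j, g ≤ ‖h j‖ ^ 2) (hs : ∀ x, Summable fun j => ‖⟪h j, x⟫_ℂ‖ ^ 2) (c : ℕ → ℝ)
    (hc : ∀ i, 0 ≤ c i) (hcb : ∀ i, c i ≤ b)
    (hsum : Tendsto (fun n => ∑ i ∈ Finset.range n, c i) atTop atTop) :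
    ∃ f : ℕ → H, (∀ i, ‖f i‖ ^ 2 = c i) ∧
      ∀ x, HasSum (fun i => ‖⟪f i, x⟫_ℂ‖ ^ 2) (‖⟪p, x⟫_ℂ‖ ^ 2 + ∑' j, ‖⟪h j, x⟫_ℂ‖ ^ 2) := by
  have hb : 0 ≤ b := (hc 0).trans (hcb 0)
  have hg : 0 < g := hb.trans_lt hbg
  have step := fun (p : H) (j i : ℕ) => exists_greedy_step hbg hg p (h j) (hc i) (hcb i) (hh j)
  choose F P' e hF he using step
  -- The state is the carried remainder together with the number of vectors `h j` used so far.
  let st : ℕ → H × ℕ := fun n => Nat.rec (p, 0)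
    (fun i s => (P' s.1 s.2 i, s.2 + e s.1 s.2 i)) n
  let P : ℕ → H := fun n => (st n).1
  let J : ℕ → ℕ := fun n => (st n).2
  have hP : ∀ n, P (n + 1) = P' (P n) (J n) n := fun n => rfl
  have hJ : ∀ n, J (n + 1) = J n + e (P n) (J n) n := fun n => rfl
  have hP0 : P 0 = p := rfl
  have hJ0 : J 0 = 0 := rfl
  clear_value P J
  let f : ℕ → H := fun i => F (P i) (J i) i
  have hf : ∀ i, ‖f i‖ ^ 2 = c i := fun i => hF _ _ _
  have hJmono : Monotone J := monotone_nat_of_le_succ fun n => by rw [hJ]; omega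
  have hnorm : ∀ n, ∑ i ∈ Finset.range n, c i + ‖P n‖ ^ 2
      = ‖p‖ ^ 2 + ∑ j ∈ Finset.range (J n), ‖h j‖ ^ 2 := by
    intro n
    induction n with
    | zero => simp [hP0, hJ0]
    | succ n ih =>
      rw [Finset.sum_range_succ, hP, hJ]
      rcases he (P n) (J n) n with ⟨h0, h1, -⟩ | ⟨h0, h1, -⟩
      · rw [h0, add_zero]; linarith
      · rw [h0, Finset.sum_range_succ]; linarith
  have hinner : ∀ x n, ∑ i ∈ Finset.range n, ‖⟪f i, x⟫_ℂ‖ ^ 2 + ‖⟪P n, x⟫_ℂ‖ ^ 2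
      = ‖⟪p, x⟫_ℂ‖ ^ 2 + ∑ j ∈ Finset.range (J n), ‖⟪h j, x⟫_ℂ‖ ^ 2 := by
    intro x n
    induction n with
    | zero => simp [hP0, hJ0]
    | succ n ih =>
      rw [Finset.sum_range_succ, hP, hJ]
      rcases he (P n) (J n) n with ⟨h0, -, h1⟩ | ⟨h0, -, h1, -⟩
      · rw [h0, add_zero]; linarith [h1 x]
      · rw [h0, Finset.sum_range_succ]; linarith [h1 x]
  -- If fewer than `M` of the `h j` were ever used, the norm balance would bound `∑ c i`.
  have hJtop : Tendsto J atTop atTop := by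
    refine tendsto_atTop_atTop_of_monotone hJmono fun M => ?_
    by_contra! hM
    obtain ⟨n, hn⟩ := (hsum.eventually_gt_atTop
      (‖p‖ ^ 2 + ∑ j ∈ Finset.range M, ‖h j‖ ^ 2)).exists
    have h1 := hnorm n
    have h2 : ∑ j ∈ Finset.range (J n), ‖h j‖ ^ 2 ≤ ∑ j ∈ Finset.range M, ‖h j‖ ^ 2 :=
      Finset.sum_le_sum_of_subset_of_nonneg (Finset.range_mono (hM n).le)
        fun _ _ _ => sq_nonneg _
    linarith [sq_nonneg ‖P n‖]
  have hq1 : √(b / g) < 1 := by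
    rw [Real.sqrt_lt' one_pos, one_pow, div_lt_one hg]
    exact hbg
  have hPx : ∀ x, Tendsto (fun n => ‖⟪P n, x⟫_ℂ‖ ^ 2) atTop (𝓝 0) := by
    intro x
    -- A majorant of the remainder indexed by the number of used `h j` rather than by time: a step
    -- that uses no new vector does not increase the remainder's form.
    let u : ℕ → ℝ := fun n => Nat.rec (‖⟪p, x⟫_ℂ‖ ^ 2)
      (fun j v => √(b / g) * v + (1 - √(b / g))⁻¹ * ‖⟪h j, x⟫_ℂ‖ ^ 2) n
    have hu : ∀ j, u (j + 1) = √(b / g) * u j + (1 - √(b / g))⁻¹ * ‖⟪h j, x⟫_ℂ‖ ^ 2 :=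
      fun j => rfl
    have hu0 : u 0 = ‖⟪p, x⟫_ℂ‖ ^ 2 := rfl
    clear_value u
    have hb0 : ∀ j, 0 ≤ (1 - √(b / g))⁻¹ * ‖⟪h j, x⟫_ℂ‖ ^ 2 := fun j =>
      mul_nonneg (inv_nonneg.2 (by linarith)) (sq_nonneg _)
    have hunn : ∀ j, 0 ≤ u j := by
      intro j
      induction j with
      | zero => rw [hu0]; positivity
      | succ j ih => rw [hu]; have := hb0 j; positivity
    have hlim : Tendsto u atTop (𝓝 0) :=
      tendsto_zero_of_le_mul_add (Real.sqrt_nonneg _) hq1 hunn hb0 ((hs x).mul_left _)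
        fun j => (hu j).le
    have hle : ∀ n, ‖⟪P n, x⟫_ℂ‖ ^ 2 ≤ u (J n) := by
      intro n
      induction n with
      | zero => rw [hP0, hJ0, hu0]
      | succ n ih =>
        rw [hP, hJ]
        rcases he (P n) (J n) n with ⟨h0, -, h1⟩ | ⟨h0, -, -, h1⟩
        · rw [h0, add_zero]
          nlinarith [h1 x, sq_nonneg ‖⟪F (P n) (J n) n, x⟫_ℂ‖]
        · rw [h0, hu]
          refine (h1 x).trans ?_
          gcongr
    exact squeeze_zero (fun n => sq_nonneg _) hle (hlim.comp hJtop)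
  refine ⟨f, hf, fun x => ?_⟩
  rw [hasSum_iff_tendsto_nat_of_nonneg fun i => sq_nonneg _]
  have h1 : Tendsto (fun n => ‖⟪p, x⟫_ℂ‖ ^ 2 + ∑ j ∈ Finset.range (J n), ‖⟪h j, x⟫_ℂ‖ ^ 2)
      atTop (𝓝 (‖⟪p, x⟫_ℂ‖ ^ 2 + ∑' j, ‖⟪h j, x⟫_ℂ‖ ^ 2)) :=
    tendsto_const_nhds.add ((hs x).hasSum.tendsto_sum_nat.comp hJtop)
  have h2 := h1.sub (hPx x)
  rw [sub_zero] at h2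
  refine h2.congr fun n => ?_
  rw [← hinner x n, add_sub_cancel_right]

/-- A family consisting of infinitely many long vectors `q n` and of arbitrary vectors `r n` can be
redistributed to any prescribed sequence of small squared norms with infinite sum. -/
theorem exists_redistribution_of_family {b g : ℝ} (hbg : b < g) (q r : ℕ → H)
    (hq : ∀ j, g ≤ ‖q j‖ ^ 2) (hqs : ∀ x, Summable fun j => ‖⟪q j, x⟫_ℂ‖ ^ 2)
    (hrs : ∀ x, Summable fun j => ‖⟪r j, x⟫_ℂ‖ ^ 2) (c : ℕ → ℝ)
    (hc : ∀ i, 0 ≤ c i) (hcb : ∀ i, c i ≤ b)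
    (hsum : Tendsto (fun n => ∑ i ∈ Finset.range n, c i) atTop atTop) :
    ∃ f : ℕ → H, (∀ i, ‖f i‖ ^ 2 = c i) ∧
      ∀ x, HasSum (fun i => ‖⟪f i, x⟫_ℂ‖ ^ 2)
        (∑' j, ‖⟪r j, x⟫_ℂ‖ ^ 2 + ∑' j, ‖⟪q j, x⟫_ℂ‖ ^ 2) := by
  have hb : 0 ≤ b := (hc 0).trans (hcb 0)
  -- Two rounds: the long vectors are divided into infinitely many sequences, the `n`-th of which
  -- absorbs `r n` and is rewritten with constant squared norm `d`. All resulting vectors are longer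
  -- than the `c i` allow, since `b < d`, and can be redistributed once more.
  obtain ⟨d, hbd, hdg⟩ := exists_between hbg
  have hd : 0 < d := hb.trans_lt hbd
  have hq2 : ∀ x, Summable fun z : ℕ × ℕ => ‖⟪q (Nat.pair z.1 z.2), x⟫_ℂ‖ ^ 2 := fun x =>
    (Nat.pairEquiv.summable_iff (f := fun j => ‖⟪q j, x⟫_ℂ‖ ^ 2)).2 (hqs x)
  have hconst : Tendsto (fun n : ℕ => ∑ i ∈ Finset.range n, d) atTop atTop := by
    simpa using tendsto_natCast_atTop_atTop.atTop_mul_const hd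
  choose F hF hFx using fun n => exists_redistribution hdg (r n) (fun k => q (Nat.pair n k))
    (fun k => hq _) (fun x => (hq2 x).prod_factor n) (fun _ => d) (fun _ => hd.le)
    (fun _ => le_rfl) hconst
  have hFs : ∀ x, Summable fun z : ℕ × ℕ => ‖⟪F z.1 z.2, x⟫_ℂ‖ ^ 2 := by
    intro x
    rw [summable_prod_of_nonneg fun z => sq_nonneg _]
    refine ⟨fun n => (hFx n x).summable, ?_⟩
    simp only [(hFx _ x).tsum_eq]
    exact (hrs x).add (hq2 x).prod
  have hFt : ∀ x, ∑' z : ℕ × ℕ, ‖⟪F z.1 z.2, x⟫_ℂ‖ ^ 2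
      = ∑' j, ‖⟪r j, x⟫_ℂ‖ ^ 2 + ∑' j, ‖⟪q j, x⟫_ℂ‖ ^ 2 := by
    intro x
    rw [(hFs x).tsum_prod]
    simp only [(hFx _ x).tsum_eq]
    rw [(hrs x).tsum_add (hq2 x).prod, ← (hq2 x).tsum_prod]
    congr 1
    exact Nat.pairEquiv.tsum_eq fun j => ‖⟪q j, x⟫_ℂ‖ ^ 2
  obtain ⟨f, hf, hfx⟩ := exists_redistribution hbd (0 : H)
    (fun j => F (Nat.unpair j).1 (Nat.unpair j).2) (fun j => (hF _ _).ge)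
    (fun x => (Nat.pairEquiv.symm.summable_iff
      (f := fun z : ℕ × ℕ => ‖⟪F z.1 z.2, x⟫_ℂ‖ ^ 2)).2 (hFs x)) c hc hcb hsum
  refine ⟨f, hf, fun x => ?_⟩
  have h1 : ∑' j, ‖⟪F (Nat.unpair j).1 (Nat.unpair j).2, x⟫_ℂ‖ ^ 2 = _ :=
    (Nat.pairEquiv.symm.tsum_eq fun z : ℕ × ℕ => ‖⟪F z.1 z.2, x⟫_ℂ‖ ^ 2).trans (hFt x)
  simpa [h1] using hfx x

end

/-! ### From quadratic forms to rank one decompositions and frames. -/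

section

variable {H : Type*} [NormedAddCommGroup H] [InnerProductSpace ℂ H]

/-- Distinct orthonormal vectors are at distance `√2`, so balls of radius `1 / 2` around them are
disjoint. -/
theorem countable_of_orthonormal [TopologicalSpace.SeparableSpace H] {w : Set H}
    (hw : Orthonormal ℂ ((↑) : w → H)) : w.Countable := by
  refine Set.PairwiseDisjoint.countable_of_isOpen (s := fun v : H => Metric.ball v (1 / 2))
    (fun u hu v hv huv => ?_) (fun v _ => Metric.isOpen_ball)
    (fun v _ => ⟨v, Metric.mem_ball_self (by norm_num)⟩)
  refine Metric.ball_disjoint_ball ?_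
  have huv0 : ⟪u, v⟫_ℂ = 0 := hw.2 (i := ⟨u, hu⟩) (j := ⟨v, hv⟩) fun h => huv (Subtype.ext_iff.1 h)
  have h1 : ‖u‖ = 1 := hw.1 ⟨u, hu⟩
  have h2 : ‖v‖ = 1 := hw.1 ⟨v, hv⟩
  rw [dist_eq_norm]
  have h3 : ‖u - v‖ ^ 2 = 2 := by
    rw [@norm_sub_sq ℂ, huv0, h1, h2]
    norm_num
  nlinarith [norm_nonneg (u - v)]

/-- `T - ∑ f k ⊗ f k`. -/
noncomputable def subRankOnes (T : H →L[ℂ] H) (f : ℕ → H) (F : Finset ℕ) : H →L[ℂ] H :=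
  T - ∑ k ∈ F, InnerProductSpace.rankOne ℂ (f k) (f k)

theorem subRankOnes_apply (T : H →L[ℂ] H) (f : ℕ → H) (F : Finset ℕ) (x : H) :
    subRankOnes T f F x = T x - ∑ k ∈ F, ⟪f k, x⟫_ℂ • f k := by
  simp [subRankOnes]

theorem re_inner_subRankOnes (T : H →L[ℂ] H) (f : ℕ → H) (F : Finset ℕ) (x : H) :
    (⟪x, subRankOnes T f F x⟫_ℂ).re = (⟪x, T x⟫_ℂ).re - ∑ k ∈ F, ‖⟪f k, x⟫_ℂ‖ ^ 2 := by
  rw [subRankOnes_apply, inner_sub_right, inner_sum, Complex.sub_re, Complex.re_sum]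
  congr 1
  refine Finset.sum_congr rfl fun k _ => ?_
  rw [inner_smul_right, ← inner_conj_symm x, Complex.mul_conj, Complex.ofReal_re,
    Complex.normSq_eq_norm_sq]

/-- The part of a countable set outside the range of an injective sequence can be enumerated, with
a padding value `z`. -/
theorem exists_seq_complement {X : Type*} {q : ℕ → X} (hq : Function.Injective q) {w : Set X}
    (hw : w.Countable) (hqw : Set.range q ⊆ w) (z : X) :
    ∃ e : ℕ → X, ∀ (F : X → ℝ) (a : ℝ), F z = 0 → HasSum (fun i : w => F i) a →
      Summable (fun n => F (q n)) ∧ Summable (fun n => F (e n)) ∧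
        ∑' n, F (e n) + ∑' n, F (q n) = a := by
  obtain ⟨ι, hι⟩ := (hw.mono (Set.sdiff_subset (t := Set.range q))).to_subtype.exists_injective_nat
  refine ⟨Function.extend ι (fun i => (i : X)) fun _ => z, fun F a hz ha => ?_⟩
  have hq1 : Summable fun i : Set.range q => F i :=
    ha.summable.comp_injective (i := Set.inclusion hqw) (Set.inclusion_injective hqw)
  have he1 : Summable fun i : ↥(w \ Set.range q) => F i :=
    ha.summable.comp_injective (i := Set.inclusion Set.sdiff_subset)
      (Set.inclusion_injective Set.sdiff_subset)
  have hsum := HasSum.add_disjoint (f := F) Set.disjoint_sdiff_right hq1.hasSum he1.hasSum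
  rw [Set.union_sdiff_cancel hqw] at hsum
  have hext : (fun n => F (Function.extend ι (fun i => (i : X)) (fun _ => z) n))
      = Function.extend ι (fun i => F i) 0 := by
    funext n
    by_cases hn : ∃ i, ι i = n
    · obtain ⟨i, rfl⟩ := hn
      simp [hι.extend_apply]
    · simp [Function.extend_apply' _ _ _ hn, hz]
  refine ⟨hq1.comp_injective (i := Set.rangeFactorization q)
    (Set.rangeFactorization_injective.2 hq), ?_, ?_⟩
  · rw [hext]
    exact (summable_extend_zero hι).2 he1
  · rw [hext, tsum_extend_zero hι, ha.unique hsum, add_comm]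
    congr 1
    exact (tsum_range F hq).symm

variable [CompleteSpace H]

/-- An orthonormal sequence can be completed by a sequence to a Parseval frame. -/
theorem exists_parseval_complement [TopologicalSpace.SeparableSpace H] {q : ℕ → H}
    (hq : Orthonormal ℂ q) :
    -- The rest of an orthonormal basis may be finite or empty, so it is padded with zeros; hence a
    -- Parseval frame rather than a basis.
    ∃ e : ℕ → H, ∀ y, Summable (fun n => ‖⟪q n, y⟫_ℂ‖ ^ 2) ∧
      Summable (fun n => ‖⟪e n, y⟫_ℂ‖ ^ 2) ∧
      ∑' n, ‖⟪e n, y⟫_ℂ‖ ^ 2 + ∑' n, ‖⟪q n, y⟫_ℂ‖ ^ 2 = ‖y‖ ^ 2 := by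
  obtain ⟨w, b, hsw, hb⟩ := hq.toSubtypeRange.exists_hilbertBasis_extension
  have hw : w.Countable := countable_of_orthonormal (hb ▸ b.orthonormal)
  obtain ⟨e, he⟩ := exists_seq_complement hq.linearIndependent.injective hw hsw 0
  refine ⟨e, fun y => he (fun v => ‖⟪v, y⟫_ℂ‖ ^ 2) _ (by simp) ?_⟩
  have h1 := Complex.hasSum_re (b.hasSum_inner_mul_inner y y)
  rw [hb] at h1
  convert! h1 using 1
  · funext i
    rw [← inner_conj_symm y, ← Complex.normSq_eq_conj_mul_self, Complex.ofReal_re,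
      Complex.normSq_eq_norm_sq]
  · exact (inner_self_eq_norm_sq (𝕜 := ℂ) y).symm

theorem exists_sqrt {T : H →L[ℂ] H} (hT : T.IsPositive) :
    ∃ R : H →L[ℂ] H, (∀ x y, ⟪R x, y⟫_ℂ = ⟪x, R y⟫_ℂ) ∧ (∀ x, R (R x) = T x) ∧
      ∀ x, ‖R x‖ ^ 2 = (⟪x, T x⟫_ℂ).re := by
  have hT0 := (ContinuousLinearMap.nonneg_iff_isPositive T).2 hT
  have hR := (ContinuousLinearMap.nonneg_iff_isPositive _).1 (CFC.sqrt_nonneg T)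
  have hRR : ∀ x, CFC.sqrt T (CFC.sqrt T x) = T x := fun x =>
    congrArg (fun A : H →L[ℂ] H => A x) (CFC.sqrt_mul_sqrt_self T hT0)
  refine ⟨CFC.sqrt T, hR.inner_left_eq_inner_right, hRR, fun x => ?_⟩
  rw [← hRR x, ← hR.inner_left_eq_inner_right]
  exact (inner_self_eq_norm_sq (𝕜 := ℂ) _).symm

/-- With `R` the square root of `T`, `T x = R (R x)` and `‖R‖ ^ 2 ≤ ‖T‖`. For positive operators of
bounded norm this upgrades convergence of forms to zero to strong convergence. -/
theorem IsPositive.norm_apply_sq_le {T : H →L[ℂ] H} (hT : T.IsPositive) (x : H) :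
    ‖T x‖ ^ 2 ≤ ‖T‖ * (⟪x, T x⟫_ℂ).re := by
  obtain ⟨R, hsymm, hRR, hR⟩ := exists_sqrt hT
  have h1 : ‖R‖ ^ 2 ≤ ‖T‖ := by
    have h2 : ‖R‖ ≤ √‖T‖ := by
      refine R.opNorm_le_bound (Real.sqrt_nonneg _) fun y => ?_
      refine le_of_sq_le_sq ?_ (by positivity)
      rw [hR, mul_pow, Real.sq_sqrt (norm_nonneg _)]
      calc (⟪y, T y⟫_ℂ).re ≤ ‖⟪y, T y⟫_ℂ‖ := Complex.re_le_norm _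
        _ ≤ ‖y‖ * ‖T y‖ := norm_inner_le_norm _ _
        _ ≤ ‖y‖ * (‖T‖ * ‖y‖) := by gcongr; exact T.le_opNorm y
        _ = ‖T‖ * ‖y‖ ^ 2 := by ring
    calc ‖R‖ ^ 2 ≤ √‖T‖ ^ 2 := by gcongr
      _ = ‖T‖ := Real.sq_sqrt (norm_nonneg _)
  rw [← hR, ← hRR]
  calc ‖R (R x)‖ ^ 2 ≤ (‖R‖ * ‖R x‖) ^ 2 := by gcongr; exact R.le_opNorm _
    _ = ‖R‖ ^ 2 * ‖R x‖ ^ 2 := by ring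
    _ ≤ _ := by gcongr

theorem isPositive_subRankOnes {T : H →L[ℂ] H} (hT : T.IsPositive) (f : ℕ → H) (F : Finset ℕ)
    (h : ∀ x, ∑ k ∈ F, ‖⟪f k, x⟫_ℂ‖ ^ 2 ≤ (⟪x, T x⟫_ℂ).re) : (subRankOnes T f F).IsPositive := by
  have hsum : (∑ k ∈ F, InnerProductSpace.rankOne ℂ (f k) (f k) : H →L[ℂ] H).IsPositive :=
    ContinuousLinearMap.isPositive_sum F fun k _ => InnerProductSpace.isPositive_rankOne_self _
  have hsa : IsSelfAdjoint (subRankOnes T f F) := hT.isSelfAdjoint.sub hsum.isSelfAdjoint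
  refine ContinuousLinearMap.isPositive_def'.2 ⟨hsa, fun x => ?_⟩
  have h1 : (subRankOnes T f F).reApplyInnerSelf x = (⟪x, subRankOnes T f F x⟫_ℂ).re :=
    inner_re_symm (𝕜 := ℂ) _ _
  rw [h1, re_inner_subRankOnes]
  linarith [h x]

/-- A positive operator with infinitely many orthonormal `q n` on which its quadratic form exceeds
the bounded sequence `c` is the sum of rank one operators with prescribed traces `c i`. -/
theorem exists_decomposition [TopologicalSpace.SeparableSpace H] {T : H →L[ℂ] H}
    (hT : T.IsPositive) {b g : ℝ} (hbg : b < g) {q : ℕ → H} (hq : Orthonormal ℂ q)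
    (hqT : ∀ n, g ≤ (⟪q n, T (q n)⟫_ℂ).re) (c : ℕ → ℝ) (hc : ∀ i, 0 ≤ c i)
    (hcb : ∀ i, c i ≤ b) (hsum : Tendsto (fun n => ∑ i ∈ Finset.range n, c i) atTop atTop) :
    ∃ f : ℕ → H, (∀ i, ‖f i‖ ^ 2 = c i) ∧
      ∀ x, HasSum (fun i => ‖⟪f i, x⟫_ℂ‖ ^ 2) (⟪x, T x⟫_ℂ).re := by
  obtain ⟨e, he⟩ := exists_parseval_complement hq
  obtain ⟨R, hsymm, hRR, hR⟩ := exists_sqrt hT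
  obtain ⟨f, hf, hfx⟩ := exists_redistribution_of_family hbg (fun n => R (q n)) (fun n => R (e n))
    (fun n => (hqT n).trans (hR _).ge) (fun x => by simpa only [hsymm] using (he (R x)).1)
    (fun x => by simpa only [hsymm] using (he (R x)).2.1) c hc hcb hsum
  refine ⟨f, hf, fun x => ?_⟩
  have := hfx x
  simp only [hsymm] at this
  rwa [(he (R x)).2.2, hR] at this

/-- If the quadratic form of the positive invertible operator `S` is `∑ |⟨f k, x⟩| ^ 2`, then `f`
is a frame with frame operator `S`. -/
theorem frameAdmissible_of_hasSum {S : H →L[ℂ] H} (hpos : S.IsPositive) (hinv : IsUnit S)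
    {c : ℕ → ℝ} (f : ℕ → H) (hf : ∀ i, ‖f i‖ ^ 2 = c i)
    (hsum : ∀ x, HasSum (fun i => ‖⟪f i, x⟫_ℂ‖ ^ 2) (⟪x, S x⟫_ℂ).re) : FrameAdmissible S c := by
  refine ⟨f, ?_, fun x => ?_, hf⟩
  · obtain ⟨u, rfl⟩ := hinv
    obtain ⟨R, hsymm, hRR, hR⟩ := exists_sqrt hpos
    set D := ‖(↑u⁻¹ : H →L[ℂ] H)‖ * ‖R‖ with hD
    have hD0 : 0 ≤ D := by positivity
    -- The lower bound comes from `x = S⁻¹ R (R x)`; adding `1` keeps both constants positive even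
    -- if `H` is trivial.
    refine ⟨((D + 1) ^ 2)⁻¹, ‖(u : H →L[ℂ] H)‖ + 1, by positivity, by positivity, fun x =>
      ⟨(hsum x).summable, ?_, ?_⟩⟩
    · rw [(hsum x).tsum_eq, ← hR, inv_mul_le_iff₀ (by positivity), ← mul_pow]
      have h1 : x = (↑u⁻¹ : H →L[ℂ] H) (R (R x)) := by
        rw [hRR]
        exact (congrArg (fun A : H →L[ℂ] H => A x) u.inv_mul).symm
      have h2 : ‖x‖ ≤ D * ‖R x‖ := by
        calc ‖x‖ = ‖(↑u⁻¹ : H →L[ℂ] H) (R (R x))‖ := by rw [← h1]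
          _ ≤ ‖(↑u⁻¹ : H →L[ℂ] H)‖ * (‖R‖ * ‖R x‖) :=
            (ContinuousLinearMap.le_opNorm _ _).trans (by gcongr; exact R.le_opNorm _)
          _ = D * ‖R x‖ := by rw [hD]; ring
      gcongr
      nlinarith [norm_nonneg (R x)]
    · rw [(hsum x).tsum_eq]
      calc (⟪x, (u : H →L[ℂ] H) x⟫_ℂ).re ≤ ‖⟪x, (u : H →L[ℂ] H) x⟫_ℂ‖ := Complex.re_le_norm _
        _ ≤ ‖x‖ * ‖(u : H →L[ℂ] H) x‖ := norm_inner_le_norm _ _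
        _ ≤ ‖x‖ * (‖(u : H →L[ℂ] H)‖ * ‖x‖) := by
          gcongr; exact ContinuousLinearMap.le_opNorm _ x
        _ ≤ _ := by nlinarith [sq_nonneg ‖x‖]
  -- The remainders `S - ∑ f k ⊗ f k` over finite sets lie between `0` and `S`, so their norms are
  -- bounded and convergence of their forms suffices.
  · have hpF : ∀ F, (subRankOnes S f F).IsPositive := fun F =>
      isPositive_subRankOnes hpos f F fun y =>
        sum_le_hasSum F (fun _ _ => sq_nonneg _) (hsum y)
    have hnorm : ∀ F, ‖subRankOnes S f F‖ ≤ ‖S‖ := fun F =>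
      CStarAlgebra.norm_le_norm_of_nonneg_of_le
        ((ContinuousLinearMap.nonneg_iff_isPositive _).2 (hpF F)) (by
          rw [ContinuousLinearMap.le_def, subRankOnes, sub_sub_cancel]
          exact ContinuousLinearMap.isPositive_sum F fun k _ =>
            InnerProductSpace.isPositive_rankOne_self _)
    have hlim : Tendsto (fun F => ‖S‖ * (⟪x, subRankOnes S f F x⟫_ℂ).re) atTop (𝓝 0) := by
      have h1 : Tendsto (fun F : Finset ℕ => (⟪x, S x⟫_ℂ).re - ∑ k ∈ F, ‖⟪f k, x⟫_ℂ‖ ^ 2)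
          atTop (𝓝 0) := by
        have h2 : Tendsto (fun F : Finset ℕ => ∑ k ∈ F, ‖⟪f k, x⟫_ℂ‖ ^ 2) atTop
          (𝓝 (⟪x, S x⟫_ℂ).re) := hsum x
        simpa using h2.const_sub (⟪x, S x⟫_ℂ).re
      simpa [re_inner_subRankOnes] using h1.const_mul ‖S‖
    have h0 : Tendsto (fun F => ‖subRankOnes S f F x‖ ^ 2) atTop (𝓝 0) :=
      squeeze_zero (fun F => sq_nonneg _) (fun F => (IsPositive.norm_apply_sq_le (hpF F) x).trans
        (mul_le_mul_of_nonneg_right (hnorm F) ((hpF F).re_inner_nonneg_right x))) hlim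
    have h3 : Tendsto (fun F => ‖subRankOnes S f F x‖) atTop (𝓝 0) := by
      have := h0.sqrt
      simpa [Real.sqrt_sq (norm_nonneg _)] using this
    have h4 := (tendsto_zero_iff_norm_tendsto_zero.2 h3).const_sub (S x)
    have h5 : Tendsto (fun F : Finset ℕ => ∑ k ∈ F, ⟪f k, x⟫_ℂ • f k) atTop (𝓝 (S x)) := by
      simpa [subRankOnes_apply] using h4
    exact h5

end

/-! ### Essential norm and top eigenvectors. -/

section

variable {H : Type*} [NormedAddCommGroup H] [InnerProductSpace ℂ H]

theorem mem_orthogonal_span_iff {s : Set H} {x : H} :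
    x ∈ (Submodule.span ℂ s)ᗮ ↔ ∀ v ∈ s, ⟪v, x⟫_ℂ = 0 := by
  refine ⟨fun h v hv => h v (Submodule.subset_span hv), fun h v hv => ?_⟩
  induction hv using Submodule.span_induction with
  | mem v hv => exact h v hv
  | zero => simp
  | add u v _ _ hu hv => rw [inner_add_left, hu, hv, add_zero]
  | smul a v _ hv => rw [inner_smul_left, hv, mul_zero]

theorem essNorm_le (S K : H →L[ℂ] H) (hK : IsCompactOperator K) : essNorm S ≤ ‖S + K‖ :=
  ciInf_le (f := fun K : {K : H →L[ℂ] H // IsCompactOperator K} => ‖S + (K : H →L[ℂ] H)‖)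
    ⟨0, by rintro _ ⟨K, rfl⟩; exact norm_nonneg _⟩ ⟨K, hK⟩

theorem exists_norm_add_lt {S : H →L[ℂ] H} {m : ℝ} (h : essNorm S < m) :
    ∃ K : H →L[ℂ] H, IsCompactOperator K ∧ ‖S + K‖ < m := by
  have : Nonempty {K : H →L[ℂ] H // IsCompactOperator K} := ⟨0, isCompactOperator_zero⟩
  obtain ⟨K, hK⟩ := exists_lt_of_ciInf_lt h
  exact ⟨K, K.2, hK⟩

/-- The vectors `q 0, …, q (n - 1)` are orthonormal eigenvectors of `S` for its `n` largest
eigenvalues `l 0 ≥ … ≥ l (n - 1)`. -/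
structure IsTopFlag (S : H →L[ℂ] H) (n : ℕ) (q : ℕ → H) (l : ℕ → ℝ) : Prop where
  norm : ∀ i < n, ‖q i‖ = 1
  orth : ∀ i j, i < j → j < n → ⟪q i, q j⟫_ℂ = 0
  eig : ∀ i < n, S (q i) = (l i : ℂ) • q i
  top : ∀ i < n, ∀ x, (∀ j < i, ⟪q j, x⟫_ℂ = 0) → (⟪x, S x⟫_ℂ).re ≤ l i * ‖x‖ ^ 2

theorem IsTopFlag.re_inner {S : H →L[ℂ] H} {n : ℕ} {q : ℕ → H} {l : ℕ → ℝ}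
    (h : IsTopFlag S n q l) {i : ℕ} (hi : i < n) : (⟪q i, S (q i)⟫_ℂ).re = l i := by
  rw [h.eig i hi, inner_smul_right, inner_self_eq_norm_sq_to_K, h.norm i hi]
  simp

theorem IsTopFlag.mono {S : H →L[ℂ] H} {n m : ℕ} {q : ℕ → H} {l : ℕ → ℝ}
    (h : IsTopFlag S n q l) (hm : m ≤ n) : IsTopFlag S m q l :=
  ⟨fun i hi => h.norm i (by omega), fun i j hij hj => h.orth i j hij (by omega),
    fun i hi => h.eig i (by omega), fun i hi => h.top i (by omega)⟩

variable [CompleteSpace H]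

/-- If the form were at most `g` on unit vectors, then `‖T x‖ ^ 2 ≤ ‖T‖ * g * ‖x‖ ^ 2`, hence `‖T‖ ≤
g`. -/
theorem exists_lt_re_inner {T : H →L[ℂ] H} (hT : T.IsPositive) {g : ℝ} (hg : 0 ≤ g)
    (h : g < ‖T‖) : ∃ x, ‖x‖ = 1 ∧ g < (⟪x, T x⟫_ℂ).re := by
  by_contra! hle
  have hle' : ∀ x, (⟪x, T x⟫_ℂ).re ≤ g * ‖x‖ ^ 2 := by
    intro x
    rcases eq_or_ne x 0 with rfl | hx
    · simp
    · have hx' : ‖x‖ ≠ 0 := norm_ne_zero_iff.2 hx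
      have h1 := hle (((‖x‖⁻¹ : ℝ) : ℂ) • x) (by simp [norm_smul, hx'])
      rw [map_smul, inner_smul_left, inner_smul_right, Complex.conj_ofReal, ← mul_assoc,
        ← Complex.ofReal_mul, Complex.re_ofReal_mul] at h1
      have hpos : 0 < ‖x‖ := norm_pos_iff.2 hx
      field_simp at h1
      linarith
  have hbound : ‖T‖ ≤ √(‖T‖ * g) := by
    refine T.opNorm_le_bound (Real.sqrt_nonneg _) fun x => ?_
    refine le_of_sq_le_sq ?_ (by positivity)
    rw [mul_pow, Real.sq_sqrt (by positivity), mul_assoc]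
    exact (IsPositive.norm_apply_sq_le hT x).trans (by gcongr; exact hle' x)
  have h2 := Real.sq_sqrt (mul_nonneg (norm_nonneg T) hg)
  nlinarith [norm_nonneg T]

/-- The compression of `S` to the orthogonal complement of `V`. -/
noncomputable def compression (S : H →L[ℂ] H) (V : Submodule ℂ H) : H →L[ℂ] H :=
  Vᗮ.starProjection ∘L S ∘L Vᗮ.starProjection

theorem isPositive_compression {S : H →L[ℂ] H} (hS : S.IsPositive) (V : Submodule ℂ H) :
    (compression S V).IsPositive := hS.conj_starProjection Vᗮ

theorem inner_compression (S : H →L[ℂ] H) (V : Submodule ℂ H) (x y : H) :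
    ⟪x, compression S V y⟫_ℂ = ⟪Vᗮ.starProjection x, S (Vᗮ.starProjection y)⟫_ℂ :=
  (Submodule.inner_starProjection_left_eq_right Vᗮ _ _).symm

/-- With `P` the projection onto `V` and `Q = 1 - P`, `Q S Q - S = -(P S + Q S P)`, and `P` has
finite rank. Thus passing to the complement of a finite-dimensional space cannot bring the norm
below the essential norm. -/
theorem isCompactOperator_compression_sub (S : H →L[ℂ] H) (V : Submodule ℂ H)
    [FiniteDimensional ℂ V] : IsCompactOperator (compression S V - S) := by
  have : ProperSpace V := FiniteDimensional.proper ℂ V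
  have hP : IsCompactOperator V.starProjection :=
    (isCompactOperator_of_locallyCompactSpace_dom V.orthogonalProjectionOnto).clm_comp V.subtypeL
  have h1 : IsCompactOperator (V.starProjection ∘L S) := hP.comp_clm S
  have h2 : IsCompactOperator (Vᗮ.starProjection ∘L S ∘L V.starProjection) :=
    hP.clm_comp (Vᗮ.starProjection ∘L S)
  have h3 := (h1.add h2).neg
  suffices ⇑(compression S V - S) = -(⇑(V.starProjection ∘L S)
      + ⇑(Vᗮ.starProjection ∘L S ∘L V.starProjection)) by rwa [this]
  funext x
  have hx : ∀ y, Vᗮ.starProjection y = y - V.starProjection y := fun y => by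
    rw [eq_sub_iff_add_eq, add_comm]
    exact V.starProjection_add_starProjection_orthogonal y
  simp only [compression, FunLike.coe_sub, ContinuousLinearMap.coe_comp,
    Pi.sub_apply, Pi.add_apply, Pi.neg_apply, Function.comp_apply, hx, map_sub]
  abel

theorem essNorm_le_norm_compression (S : H →L[ℂ] H) (V : Submodule ℂ H)
    [FiniteDimensional ℂ V] : essNorm S ≤ ‖compression S V‖ := by
  simpa using essNorm_le S _ (isCompactOperator_compression_sub S V)

/-- Below the essential norm, the quadratic form takes its values on unit vectors orthogonal to
any given finite set. -/
theorem exists_unit_orthogonal {S : H →L[ℂ] H} (hS : S.IsPositive) {g : ℝ} (hg : 0 ≤ g)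
    (h : g < essNorm S) {s : Set H} (hs : s.Finite) :
    ∃ q, ‖q‖ = 1 ∧ (∀ v ∈ s, ⟪v, q⟫_ℂ = 0) ∧ g < (⟪q, S q⟫_ℂ).re := by
  have : FiniteDimensional ℂ (Submodule.span ℂ s) := FiniteDimensional.span_of_finite ℂ hs
  set V := Submodule.span ℂ s with hV
  obtain ⟨x, hx, hgx⟩ := exists_lt_re_inner (isPositive_compression hS V) hg
    (h.trans_le (essNorm_le_norm_compression S V))
  rw [inner_compression] at hgx
  set y := Vᗮ.starProjection x with hy
  have hyV : y ∈ Vᗮ := Submodule.starProjection_apply_mem _ _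
  have hy1 : ‖y‖ ≤ 1 := hx ▸ Submodule.norm_starProjection_apply_le Vᗮ x
  have hy0 : y ≠ 0 := by
    intro h0
    rw [h0] at hgx
    simp at hgx
    linarith
  have hpos : 0 < ‖y‖ := norm_pos_iff.2 hy0
  refine ⟨((‖y‖⁻¹ : ℝ) : ℂ) • y, by simp [norm_smul, hpos.ne'], fun v hv => ?_, ?_⟩
  · rw [inner_smul_right, mem_orthogonal_span_iff.1 hyV v hv, mul_zero]
  · rw [map_smul, inner_smul_left, inner_smul_right, Complex.conj_ofReal, ← mul_assoc,
      ← Complex.ofReal_mul, Complex.re_ofReal_mul]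
    -- The projection has norm at most `1`, so normalizing it can only increase the form.
    refine hgx.trans_le (le_mul_of_one_le_left (hg.trans hgx.le) ?_)
    have : 1 ≤ ‖y‖⁻¹ := (one_le_inv₀ hpos).2 hy1
    nlinarith

theorem exists_orthonormal_seq {S : H →L[ℂ] H} (hS : S.IsPositive) {g : ℝ} (hg : 0 ≤ g)
    (h : g < essNorm S) {s : Set H} (hs : s.Finite) :
    ∃ q : ℕ → H, Orthonormal ℂ q ∧ (∀ n, ∀ v ∈ s, ⟪v, q n⟫_ℂ = 0) ∧
      ∀ n, g < (⟪q n, S (q n)⟫_ℂ).re := by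
  obtain ⟨q, hq, hqq⟩ := exists_seq_of_forall_finset_exists
    (fun x : H => ‖x‖ = 1 ∧ (∀ v ∈ s, ⟪v, x⟫_ℂ = 0) ∧ g < (⟪x, S x⟫_ℂ).re)
    (fun x y => ⟪x, y⟫_ℂ = 0) (fun t _ => by
      obtain ⟨x, h1, h2, h3⟩ := exists_unit_orthogonal hS hg h (hs.union t.finite_toSet)
      exact ⟨x, ⟨h1, fun v hv => h2 v (Or.inl hv), h3⟩, fun v hv => h2 v (Or.inr hv)⟩)
  refine ⟨q, ⟨fun n => (hq n).1, fun i j hij => ?_⟩, fun n => (hq n).2.1, fun n => (hq n).2.2⟩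
  rcases lt_or_gt_of_ne hij with h | h
  · exact hqq i j h
  · rw [← inner_conj_symm, hqq j i h, map_zero]

/-- A positive operator whose norm exceeds its distance from a compact operator attains its
norm. -/
theorem exists_re_inner_eq_norm {A K : H →L[ℂ] H} (hA : A.IsPositive) (hK : IsCompactOperator K)
    (h : ‖A - K‖ < ‖A‖) : ∃ x, ‖x‖ = 1 ∧ (⟪x, A x⟫_ℂ).re = ‖A‖ := by
  set m := ‖A‖ with hm
  have hm0 : 0 < m := (norm_nonneg _).trans_lt h
  have hseq : ∀ n : ℕ, ∃ x, ‖x‖ = 1 ∧ m - m / (n + 1) < (⟪x, A x⟫_ℂ).re := fun n => by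
    have h1 : m / ((n : ℝ) + 1) ≤ m := div_le_self hm0.le (by linarith [n.cast_nonneg (α := ℝ)])
    have h2 : 0 < m / ((n : ℝ) + 1) := by positivity
    exact exists_lt_re_inner hA (by linarith) (by rw [← hm]; linarith)
  choose x hx hxm using hseq
  have hle : ∀ n, (⟪x n, A (x n)⟫_ℂ).re ≤ m := fun n => by
    calc (⟪x n, A (x n)⟫_ℂ).re ≤ ‖⟪x n, A (x n)⟫_ℂ‖ := Complex.re_le_norm _
      _ ≤ ‖x n‖ * ‖A (x n)‖ := norm_inner_le_norm _ _
      _ ≤ ‖x n‖ * (‖A‖ * ‖x n‖) := by gcongr; exact A.le_opNorm _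
      _ = m := by rw [hx, hm]; ring
  have hdiv : Tendsto (fun n : ℕ => m / ((n : ℝ) + 1)) atTop (𝓝 0) :=
    by simpa [div_eq_mul_inv] using
      (tendsto_one_div_add_atTop_nhds_zero_nat (𝕜 := ℝ)).const_mul m
  have hform : Tendsto (fun n => (⟪x n, A (x n)⟫_ℂ).re) atTop (𝓝 m) :=
    tendsto_of_tendsto_of_tendsto_of_le_of_le (by simpa using hdiv.const_sub m)
      tendsto_const_nhds (fun n => (hxm n).le) hle
  -- A maximizing sequence for the form is one of approximate eigenvectors for `m`.
  have happrox : Tendsto (fun n => (m : ℂ) • x n - A (x n)) atTop (𝓝 0) := by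
    rw [tendsto_zero_iff_norm_tendsto_zero]
    have h1 : Tendsto (fun n => ‖(m : ℂ) • x n - A (x n)‖ ^ 2) atTop (𝓝 0) := by
      refine squeeze_zero (g := fun n => 2 * m ^ 2 - 2 * m * (⟪x n, A (x n)⟫_ℂ).re)
        (fun n => sq_nonneg _) (fun n => ?_) ?_
      · have h2 : ‖A (x n)‖ ≤ m := by simpa [hx] using A.le_opNorm (x n)
        have h3 : RCLike.re ⟪(m : ℂ) • x n, A (x n)⟫_ℂ = m * (⟪x n, A (x n)⟫_ℂ).re := by
          rw [inner_smul_left, Complex.conj_ofReal]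
          exact Complex.re_ofReal_mul _ _
        rw [@norm_sub_sq ℂ, h3, norm_smul, hx, Complex.norm_real, Real.norm_eq_abs,
          abs_of_pos hm0]
        nlinarith [norm_nonneg (A (x n))]
      · have := (hform.const_mul (2 * m)).const_sub (2 * m ^ 2)
        convert this using 2
        ring
    have := h1.sqrt
    simpa [Real.sqrt_sq (norm_nonneg _)] using this
  obtain ⟨y, -, φ, hφ, hy⟩ := (IsCompactOperator.isCompact_closure_image_closedBall
    (f := (K : H →ₗ[ℂ] H)) hK 1).tendsto_subseq (x := fun n => K (x n))
    fun n => subset_closure ⟨x n, by simp [hx], rfl⟩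
  have : Nontrivial H := ⟨x 0, 0, fun h0 => by simpa [h0] using hx 0⟩
  -- Since `m` exceeds `‖A - K‖`, `G = m - (A - K)` is invertible. As `G x = (m x - A x) + K x`
  -- converges along a subsequence by compactness of `K`, so does the maximizing sequence itself.
  have hres : (m : ℂ) ∈ resolventSet ℂ (A - K) :=
    spectrum.mem_resolventSet_of_norm_lt (by
      rwa [Complex.norm_real, Real.norm_eq_abs, abs_of_pos hm0])
  obtain ⟨G, hG⟩ := spectrum.mem_resolventSet_iff.1 hres
  have hGx : ∀ z, (G : H →L[ℂ] H) z = ((m : ℂ) • z - A z) + K z := by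
    intro z
    rw [hG]
    simp [Algebra.algebraMap_eq_smul_one]
    abel
  have hlim : Tendsto (fun n => (G : H →L[ℂ] H) (x (φ n))) atTop (𝓝 y) := by
    simp only [hGx]
    simpa using (happrox.comp hφ.tendsto_atTop).add hy
  have hxlim : Tendsto (fun n => x (φ n)) atTop (𝓝 ((↑G⁻¹ : H →L[ℂ] H) y)) := by
    have h1 := ((↑G⁻¹ : H →L[ℂ] H).continuous.tendsto y).comp hlim
    refine h1.congr fun n => ?_
    exact congrArg (fun B : H →L[ℂ] H => B (x (φ n))) G.inv_mul
  refine ⟨_, tendsto_nhds_unique hxlim.norm (by simp [hx]), ?_⟩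
  have h1 : Tendsto (fun n => (⟪x (φ n), A (x (φ n))⟫_ℂ).re) atTop
      (𝓝 (⟪(↑G⁻¹ : H →L[ℂ] H) y, A ((↑G⁻¹ : H →L[ℂ] H) y)⟫_ℂ).re) :=
    (Complex.continuous_re.tendsto _).comp
      (hxlim.inner ((A.continuous.tendsto _).comp hxlim))
  exact tendsto_nhds_unique h1 (hform.comp hφ.tendsto_atTop)

/-- Otherwise a unit vector orthogonal to the earlier eigenvectors would have form larger than `l
i`, against the maximality of `l i`. -/
theorem IsTopFlag.essNorm_le {S : H →L[ℂ] H} (hS : S.IsPositive) {n : ℕ} {q : ℕ → H} {l : ℕ → ℝ}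
    (h : IsTopFlag S n q l) {i : ℕ} (hi : i < n) : essNorm S ≤ l i := by
  by_contra! hlt
  have h0 : 0 ≤ l i := by
    rw [← h.re_inner hi]
    exact hS.re_inner_nonneg_right _
  obtain ⟨x, hx, hxo, hxl⟩ := exists_unit_orthogonal hS h0 hlt ((Set.finite_Iio i).image q)
  have := h.top i hi x fun j hj => hxo _ ⟨j, hj, rfl⟩
  rw [hx] at this
  linarith

/-- The alternative is whether the form attains the norm of the compression on the complement. A
maximizer is an eigenvector; without one this norm is at most `‖S‖ₑ`, and non-attainment makes the
inequality strict. Strictness matters because the interval defining `P₂(S)` contains `‖S‖ₑ`. -/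
theorem IsTopFlag.extend {S : H →L[ℂ] H} (hS : S.IsPositive) {n : ℕ} {q : ℕ → H} {l : ℕ → ℝ}
    (h : IsTopFlag S n q l) : (∃ q' l', IsTopFlag S (n + 1) q' l') ∨
      ∀ x, x ≠ 0 → (∀ j < n, ⟪q j, x⟫_ℂ = 0) → (⟪x, S x⟫_ℂ).re < essNorm S * ‖x‖ ^ 2 := by
  set s := q '' Set.Iio n with hs
  have hsfin : s.Finite := (Set.finite_Iio n).image q
  have : FiniteDimensional ℂ (Submodule.span ℂ s) := FiniteDimensional.span_of_finite ℂ hsfin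
  set V := Submodule.span ℂ s with hV
  have hmem : ∀ x, x ∈ Vᗮ ↔ ∀ j < n, ⟪q j, x⟫_ℂ = 0 := fun x => by
    rw [hV, mem_orthogonal_span_iff, hs, Set.forall_mem_image]; rfl
  set A := compression S V with hAdef
  have hA : A.IsPositive := isPositive_compression hS V
  have hAS : ∀ x ∈ Vᗮ, ⟪x, A x⟫_ℂ = ⟪x, S x⟫_ℂ := fun x hx => by
    rw [hAdef, inner_compression, Submodule.starProjection_eq_self_iff.2 hx]
  have hSV : ∀ x ∈ Vᗮ, S x ∈ Vᗮ := fun x hx => by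
    rw [hmem] at hx ⊢
    intro j hj
    rw [← hS.inner_left_eq_inner_right, h.eig j hj, inner_smul_left, hx j hj, mul_zero]
  have hAx : ∀ x ∈ Vᗮ, A x = S x := fun x hx => by
    have h1 := Submodule.starProjection_eq_self_iff.2 hx
    have h2 := Submodule.starProjection_eq_self_iff.2 (hSV x hx)
    simp [hAdef, compression, h1, h2]
  have hAle : ∀ x ∈ Vᗮ, (⟪x, S x⟫_ℂ).re ≤ ‖A‖ * ‖x‖ ^ 2 := fun x hx => by
    rw [← hAS x hx]
    calc (⟪x, A x⟫_ℂ).re ≤ ‖⟪x, A x⟫_ℂ‖ := Complex.re_le_norm _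
      _ ≤ ‖x‖ * ‖A x‖ := norm_inner_le_norm _ _
      _ ≤ ‖x‖ * (‖A‖ * ‖x‖) := by gcongr; exact A.le_opNorm _
      _ = ‖A‖ * ‖x‖ ^ 2 := by ring
  by_cases hatt : ∃ x ∈ Vᗮ, ‖x‖ = 1 ∧ (⟪x, S x⟫_ℂ).re = ‖A‖
  · left
    obtain ⟨x, hxV, hx1, hxA⟩ := hatt
    have hSx : S x = ((‖A‖ : ℝ) : ℂ) • x := by
      have h1 : ‖S x‖ ≤ ‖A‖ := by
        rw [← hAx x hxV]
        simpa [hx1] using A.le_opNorm x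
      have h2 : RCLike.re ⟪((‖A‖ : ℝ) : ℂ) • x, S x⟫_ℂ = ‖A‖ * ‖A‖ := by
        rw [inner_smul_left, Complex.conj_ofReal]
        rw [← hxA]
        exact Complex.re_ofReal_mul _ _
      -- Expanding the square gives at most `‖A‖ ^ 2 - 2 * ‖A‖ ^ 2 + ‖A‖ ^ 2`.
      have h3 : ‖((‖A‖ : ℝ) : ℂ) • x - S x‖ ^ 2 ≤ 0 := by
        rw [@norm_sub_sq ℂ, h2, norm_smul, hx1, Complex.norm_real, norm_norm]
        nlinarith [norm_nonneg (S x)]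
      have h4 : ‖((‖A‖ : ℝ) : ℂ) • x - S x‖ = 0 := by
        nlinarith [norm_nonneg (((‖A‖ : ℝ) : ℂ) • x - S x)]
      exact (sub_eq_zero.1 (norm_eq_zero.1 h4)).symm
    have hq : ∀ i < n, Function.update q n x i = q i := fun i hi =>
      Function.update_of_ne hi.ne _ _
    have hl : ∀ i < n, Function.update l n ‖A‖ i = l i := fun i hi =>
      Function.update_of_ne hi.ne _ _
    refine ⟨Function.update q n x, Function.update l n ‖A‖, ?_, ?_, ?_, ?_⟩
    · intro i hi
      rcases Nat.lt_succ_iff_lt_or_eq.1 hi with hi | rfl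
      · rw [hq i hi, h.norm i hi]
      · rw [Function.update_self, hx1]
    · intro i j hij hj
      rcases Nat.lt_succ_iff_lt_or_eq.1 hj with hj | rfl
      · rw [hq i (by omega), hq j hj, h.orth i j hij hj]
      · rw [hq i hij, Function.update_self]
        exact (hmem x).1 hxV i hij
    · intro i hi
      rcases Nat.lt_succ_iff_lt_or_eq.1 hi with hi | rfl
      · rw [hq i hi, hl i hi, h.eig i hi]
      · rw [Function.update_self, Function.update_self, hSx]
    · intro i hi y hy
      rcases Nat.lt_succ_iff_lt_or_eq.1 hi with hi | rfl
      · rw [hl i hi]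
        exact h.top i hi y fun j hj => by rw [← hq j (by omega)]; exact hy j hj
      · rw [Function.update_self]
        exact hAle y ((hmem y).2 fun j hj => by rw [← hq j hj]; exact hy j hj)
  · right
    have hAess : ‖A‖ ≤ essNorm S := by
      by_contra! hlt
      obtain ⟨K, hK, hKS⟩ := exists_norm_add_lt hlt
      obtain ⟨x, hx1, hxA⟩ := exists_re_inner_eq_norm (K := (A - S) - K) hA
        ((isCompactOperator_compression_sub S V).sub hK) (by
          have : A - (A - S - K) = S + K := by abel
          rwa [this])
      rw [hAdef, inner_compression, ← hAdef] at hxA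
      set y := Vᗮ.starProjection x
      have hyV : y ∈ Vᗮ := Submodule.starProjection_apply_mem _ _
      have hy1 : ‖y‖ ≤ 1 := hx1 ▸ Submodule.norm_starProjection_apply_le Vᗮ x
      have hA0 : 0 < ‖A‖ := (norm_nonneg _).trans_lt hKS
      refine hatt ⟨y, hyV, le_antisymm hy1 ?_, hxA⟩
      have h1 := hAle y hyV
      rw [hxA] at h1
      have h2 : 1 ≤ ‖y‖ ^ 2 := le_of_mul_le_mul_left (by simpa using h1) hA0
      exact (one_le_sq_iff₀ (norm_nonneg y)).1 h2
    intro x hx0 hx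
    have hxV := (hmem x).2 hx
    have hpos : 0 < ‖x‖ := norm_pos_iff.2 hx0
    refine lt_of_le_of_ne ((hAle x hxV).trans (by gcongr)) fun heq => hatt ?_
    have heq' : (⟪x, S x⟫_ℂ).re = ‖A‖ * ‖x‖ ^ 2 :=
      le_antisymm (hAle x hxV) (heq ▸ by gcongr)
    refine ⟨((‖x‖⁻¹ : ℝ) : ℂ) • x, Submodule.smul_mem _ _ hxV, by simp [norm_smul, hpos.ne'], ?_⟩
    rw [map_smul, inner_smul_left, inner_smul_right, Complex.conj_ofReal, ← mul_assoc,
      ← Complex.ofReal_mul, Complex.re_ofReal_mul, heq']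
    field_simp

/-- Either `S` has `N` largest eigenvalues, or it has fewer and its quadratic form stays below the
essential norm on the complement of their eigenvectors. -/
theorem exists_isTopFlag {S : H →L[ℂ] H} (hS : S.IsPositive) (N : ℕ) :
    ∃ n q l, n ≤ N ∧ IsTopFlag S n q l ∧ (n = N ∨
      ∀ x, x ≠ 0 → (∀ j < n, ⟪q j, x⟫_ℂ = 0) → (⟪x, S x⟫_ℂ).re < essNorm S * ‖x‖ ^ 2) := by
  induction N with
  | zero => exact ⟨0, 0, 0, le_rfl, ⟨by simp, by simp, by simp, by simp⟩, Or.inl rfl⟩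
  | succ N ih =>
    obtain ⟨n, q, l, hn, h, rfl | hbelow⟩ := ih
    · obtain ⟨q', l', h'⟩ | hbelow := h.extend hS
      · exact ⟨n + 1, q', l', le_rfl, h', Or.inl rfl⟩
      · exact ⟨n, q, l, by omega, h, Or.inr hbelow⟩
    · exact ⟨n, q, l, by omega, h, Or.inr hbelow⟩

end

/-! ### Ky Fan's bound and the rank of the spectral projection. -/

section

variable {H : Type*} [NormedAddCommGroup H] [InnerProductSpace ℂ H]

theorem essNorm_nonneg (S : H →L[ℂ] H) : 0 ≤ essNorm S :=
  Real.iInf_nonneg fun _ => norm_nonneg _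

theorem IsTopFlag.inner_eq {S : H →L[ℂ] H} {n : ℕ} {q : ℕ → H} {l : ℕ → ℝ}
    (h : IsTopFlag S n q l) {i j : ℕ} (hi : i < n) (hj : j < n) :
    ⟪q i, q j⟫_ℂ = if i = j then 1 else 0 := by
  rcases lt_trichotomy i j with hij | rfl | hij
  · rw [if_neg hij.ne, h.orth i j hij hj]
  · rw [if_pos rfl, inner_self_eq_norm_sq_to_K, h.norm i hi]
    simp
  · rw [if_neg hij.ne', ← inner_conj_symm, h.orth j i hij hi, map_zero]

theorem IsTopFlag.eigenvalue_anti {S : H →L[ℂ] H} {n : ℕ} {q : ℕ → H} {l : ℕ → ℝ}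
    (h : IsTopFlag S n q l) {i j : ℕ} (hij : i ≤ j) (hj : j < n) : l j ≤ l i := by
  have h1 := h.top i (by omega) (q j) fun m hm => h.orth m j (by omega) hj
  rwa [h.re_inner hj, h.norm j hj, one_pow, mul_one] at h1

/-- The quadratic form of `S` is controlled by the top eigenvectors and a bound `m` on their
orthogonal complement. -/
theorem IsTopFlag.re_inner_le {S : H →L[ℂ] H} (hS : S.IsPositive) {n : ℕ} {q : ℕ → H} {l : ℕ → ℝ}
    (h : IsTopFlag S n q l) {m : ℝ}
    (hm : ∀ x, (∀ j < n, ⟪q j, x⟫_ℂ = 0) → (⟪x, S x⟫_ℂ).re ≤ m * ‖x‖ ^ 2) (x : H) :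
    (⟪x, S x⟫_ℂ).re
      ≤ ∑ i ∈ Finset.range n, (l i - m) * ‖⟪q i, x⟫_ℂ‖ ^ 2 + m * ‖x‖ ^ 2 := by
  set v := ∑ i ∈ Finset.range n, ⟪q i, x⟫_ℂ • q i with hv
  set w := x - v with hw
  have hxv : x = v + w := by rw [hw]; abel
  have hqw : ∀ j < n, ⟪q j, w⟫_ℂ = 0 := by
    intro j hj
    rw [hw, inner_sub_right, hv, inner_sum, Finset.sum_eq_single_of_mem j (Finset.mem_range.2 hj)]
    · rw [inner_smul_right, h.inner_eq hj hj, if_pos rfl, mul_one, sub_self]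
    · intro i hi hij
      rw [inner_smul_right, h.inner_eq hj (Finset.mem_range.1 hi), if_neg hij.symm, mul_zero]
  have hSv : S v = ∑ i ∈ Finset.range n, ⟪q i, x⟫_ℂ • (l i : ℂ) • q i := by
    rw [hv, map_sum]
    exact Finset.sum_congr rfl fun i hi => by rw [map_smul, h.eig i (Finset.mem_range.1 hi)]
  have hvw : ⟪v, w⟫_ℂ = 0 := by
    rw [hv, sum_inner]
    exact Finset.sum_eq_zero fun i hi => by
      rw [inner_smul_left, hqw i (Finset.mem_range.1 hi), mul_zero]
  have hSvw : ⟪S v, w⟫_ℂ = 0 := by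
    rw [hSv, sum_inner]
    exact Finset.sum_eq_zero fun i hi => by
      rw [inner_smul_left, inner_smul_left, hqw i (Finset.mem_range.1 hi), mul_zero, mul_zero]
  have hterm : ∀ i, (⟪x, ⟪q i, x⟫_ℂ • q i⟫_ℂ) = ((‖⟪q i, x⟫_ℂ‖ ^ 2 : ℝ) : ℂ) := fun i => by
    rw [inner_smul_right, ← inner_conj_symm x, Complex.mul_conj, Complex.normSq_eq_norm_sq]
  have hxSv : (⟪x, S v⟫_ℂ).re = ∑ i ∈ Finset.range n, l i * ‖⟪q i, x⟫_ℂ‖ ^ 2 := by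
    rw [hSv, inner_sum, Complex.re_sum]
    refine Finset.sum_congr rfl fun i _ => ?_
    rw [smul_comm, inner_smul_right, hterm, ← Complex.ofReal_mul, Complex.ofReal_re]
  have hxv' : (⟪x, v⟫_ℂ).re = ∑ i ∈ Finset.range n, ‖⟪q i, x⟫_ℂ‖ ^ 2 := by
    rw [hv, inner_sum, Complex.re_sum]
    exact Finset.sum_congr rfl fun i _ => by rw [hterm, Complex.ofReal_re]
  have hwn : ‖w‖ ^ 2 = ‖x‖ ^ 2 - ∑ i ∈ Finset.range n, ‖⟪q i, x⟫_ℂ‖ ^ 2 := by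
    have h1 : ⟪x, w⟫_ℂ = ⟪w, w⟫_ℂ := by rw [hxv, inner_add_left, hvw, zero_add]
    have h2 : ‖w‖ ^ 2 = (⟪w, w⟫_ℂ).re := (inner_self_eq_norm_sq (𝕜 := ℂ) w).symm
    have h3 : ‖x‖ ^ 2 = (⟪x, x⟫_ℂ).re := (inner_self_eq_norm_sq (𝕜 := ℂ) x).symm
    rw [h2, ← h1, hw, inner_sub_right, Complex.sub_re, hxv', h3]
  have hxSw : ⟪x, S w⟫_ℂ = ⟪w, S w⟫_ℂ := by
    conv_lhs => rw [hxv]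
    rw [inner_add_left, ← hS.inner_left_eq_inner_right v w, hSvw, zero_add]
  have hmain : (⟪x, S x⟫_ℂ).re = (⟪x, S v⟫_ℂ).re + (⟪w, S w⟫_ℂ).re := by
    rw [← hxSw, ← Complex.add_re, ← inner_add_right, ← map_add, ← hxv]
  have := hm w hqw
  rw [hmain, hxSv]
  simp only [sub_mul, Finset.sum_sub_distrib, ← Finset.mul_sum]
  rw [hwn] at this
  linarith

variable [CompleteSpace H]

/-- `S P` factors through the range `W` of `P`, so cyclicity of the trace moves it from the range of
`S P` to `W`, where the operator is the compression of `S` and an orthonormal basis computes its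
trace. -/
theorem exists_finTrace_eq (S : H →L[ℂ] H) {P : H →L[ℂ] H} (hP : IsStarProjection P) {k : ℕ}
    (hk : opRank P = (k : Cardinal)) :
    ∃ v : Fin k → H, Orthonormal ℂ v ∧
      (finTrace (S ∘L P)).re = ∑ i, (⟪v i, S (v i)⟫_ℂ).re := by
  set W := LinearMap.range (P : H →ₗ[ℂ] H) with hW
  have hPP : ∀ x, P (P x) = P x := fun x =>
    congrArg (fun A : H →L[ℂ] H => A x) hP.isIdempotentElem.eq
  have hPW : ∀ w : W, P w = w := by
    rintro ⟨_, x, rfl⟩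
    exact hPP x
  have hWk : Module.rank ℂ W = k := hk
  have : Module.Finite ℂ W :=
    Module.rank_lt_aleph0_iff.1 (by rw [hWk]; exact Cardinal.natCast_lt_aleph0)
  have hfin : Module.finrank ℂ W = k := Module.finrank_eq_of_rank_eq hWk
  set T : H →ₗ[ℂ] H := ((S ∘L P : H →L[ℂ] H) : H →ₗ[ℂ] H) with hT
  let f : W →ₗ[ℂ] LinearMap.range T := T.rangeRestrict ∘ₗ W.subtype
  let g : LinearMap.range T →ₗ[ℂ] W :=
    (P : H →ₗ[ℂ] H).rangeRestrict ∘ₗ (LinearMap.range T).subtype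
  have hf : Function.Surjective f := by
    rintro ⟨_, x, rfl⟩
    refine ⟨⟨P x, x, rfl⟩, Subtype.ext ?_⟩
    exact congrArg S (hPP x)
  have : Module.Finite ℂ (LinearMap.range T) := Module.Finite.of_surjective f hf
  have hfg : T.rangeRestrict ∘ₗ (LinearMap.range T).subtype = f ∘ₗ g := by
    ext r
    exact (congrArg S (hPP r)).symm
  let b := (stdOrthonormalBasis ℂ W).reindex (finCongr hfin)
  refine ⟨fun i => b i, b.orthonormal.comp_linearIsometry W.subtypeₗᵢ, ?_⟩
  have htr : finTrace (S ∘L P) = LinearMap.trace ℂ W (g ∘ₗ f) := by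
    rw [LinearMap.trace_comp_comm', ← hfg]
    rfl
  rw [htr, LinearMap.trace_eq_sum_inner _ b, Complex.re_sum]
  refine Finset.sum_congr rfl fun i _ => ?_
  have h1 : ⟪b i, (g ∘ₗ f) (b i)⟫_ℂ = ⟪(b i : H), P (S (P (b i)))⟫_ℂ := rfl
  have h2 : ∀ x y, ⟪P x, y⟫_ℂ = ⟪x, P y⟫_ℂ :=
    (ContinuousLinearMap.isSelfAdjoint_iff_isSymmetric.1 hP.isSelfAdjoint)
  rw [h1, ← h2, hPW]

/-- Ky Fan's bound: `U_k(S)` is at most the sum of the top eigenvalues, completed by a bound `m` for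
the quadratic form on the complement of their eigenvectors. -/
theorem IsTopFlag.opU_le {S : H →L[ℂ] H} (hS : S.IsPositive) {n : ℕ} {q : ℕ → H} {l : ℕ → ℝ}
    (h : IsTopFlag S n q l) {m : ℝ} (hm0 : 0 ≤ m) (hml : ∀ i < n, m ≤ l i)
    (hm : ∀ x, (∀ j < n, ⟪q j, x⟫_ℂ = 0) → (⟪x, S x⟫_ℂ).re ≤ m * ‖x‖ ^ 2) {k : ℕ} (hk : n ≤ k) :
    opU k S ≤ ∑ i ∈ Finset.range n, l i + (k - n) * m := by
  have hkn : (0 : ℝ) ≤ k - n := sub_nonneg.2 (by exact_mod_cast hk)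
  -- The bound must be nonnegative because the supremum of the empty set is `0` by convention.
  refine Real.sSup_le ?_ (add_nonneg (Finset.sum_nonneg fun i hi =>
    hm0.trans (hml i (Finset.mem_range.1 hi))) (mul_nonneg hkn hm0))
  rintro t ⟨P, hP, hPk, rfl⟩
  obtain ⟨v, hv, htr⟩ := exists_finTrace_eq S hP hPk
  rw [htr]
  calc ∑ i, (⟪v i, S (v i)⟫_ℂ).re
      ≤ ∑ j : Fin k, (∑ i ∈ Finset.range n, (l i - m) * ‖⟪q i, v j⟫_ℂ‖ ^ 2 + m) := by
        refine Finset.sum_le_sum fun j _ => ?_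
        have := h.re_inner_le hS hm (v j)
        rwa [hv.1 j, one_pow, mul_one] at this
    _ = ∑ i ∈ Finset.range n, (l i - m) * ∑ j : Fin k, ‖⟪q i, v j⟫_ℂ‖ ^ 2 + k * m := by
        rw [Finset.sum_add_distrib, Finset.sum_comm]
        simp [Finset.mul_sum]
    _ ≤ ∑ i ∈ Finset.range n, (l i - m) * 1 + k * m := by
        refine add_le_add (Finset.sum_le_sum fun i hi => ?_) le_rfl
        have hi := Finset.mem_range.1 hi
        refine mul_le_mul_of_nonneg_left ?_ (sub_nonneg.2 (hml i hi))
        -- Bessel's inequality: the total weight that the `v j` put on `q i` is at most `1`.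
        have := hv.sum_inner_products_le (q i) (s := Finset.univ)
        simp only [norm_inner_symm (v _)] at this
        rwa [h.norm i hi, one_pow] at this
    _ = _ := by
        simp only [mul_one, Finset.sum_sub_distrib, Finset.sum_const, Finset.card_range, nsmul_eq_mul]
        ring

/-- The flag is cut to length `k` and the last eigenvalue `l (k - 1)` serves as the bound on the
complement, where its coefficient is `k - k = 0`. -/
theorem IsTopFlag.opU_le_sum {S : H →L[ℂ] H} (hS : S.IsPositive) {n : ℕ} {q : ℕ → H} {l : ℕ → ℝ}
    (h : IsTopFlag S n q l) {k : ℕ} (hk : 1 ≤ k) (hkn : k ≤ n) :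
    opU k S ≤ ∑ i ∈ Finset.range k, l i := by
  have h1 := (h.mono hkn).opU_le hS (m := l (k - 1))
    ((essNorm_nonneg S).trans (h.essNorm_le hS (by omega)))
    (fun i hi => h.eigenvalue_anti (by omega) (by omega))
    (fun x hx => h.top (k - 1) (by omega) x fun j hj => hx j (by omega)) le_rfl
  simpa using h1

/-- A continuous function of compact support that vanishes on `[a, ∞)` and is at least `a - t` at
every `t ≥ 0`. -/
theorem exists_compactlySupported {a : ℝ} (ha : 0 ≤ a) :
    ∃ f : C_c(ℝ, ℝ), (∀ t, 0 ≤ f t) ∧ (∀ t, a ≤ t → f t = 0) ∧ ∀ t, 0 ≤ t → a - t ≤ f t := by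
  -- The line `(a + 1) * (t + 1)` cuts the support off at `-1` and lies above `a - t` for `t ≥ 0`.
  refine ⟨⟨⟨fun t => max 0 (min (a - t) ((a + 1) * (t + 1))), by fun_prop⟩,
    HasCompactSupport.intro (isCompact_Icc (a := -1) (b := a)) fun t ht => ?_⟩,
    fun t => le_max_left _ _, fun t ht => ?_, fun t ht => ?_⟩
  · refine max_eq_left ?_
    rw [Set.mem_Icc, not_and_or, not_le, not_le] at ht
    rcases ht with ht | ht
    · exact (min_le_right _ _).trans (by nlinarith)
    · exact (min_le_left _ _).trans (by linarith)
  · exact max_eq_left ((min_le_left _ _).trans (by linarith))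
  · exact le_max_of_le_right (le_min le_rfl (by nlinarith))

/-- If the quadratic form of `S` stays below the essential norm on the complement of `n` top
eigenvectors, then `P₂(S)` has rank at most `n`. -/
theorem IsTopFlag.opRank_P2_le {S : H →L[ℂ] H} (hS : S.IsPositive) {n : ℕ} {q : ℕ → H} {l : ℕ → ℝ}
    (h : IsTopFlag S n q l)
    (hlt : ∀ x, x ≠ 0 → (∀ j < n, ⟪q j, x⟫_ℂ = 0) → (⟪x, S x⟫_ℂ).re < essNorm S * ‖x‖ ^ 2) :
    opRank (P2 S) ≤ n := by
  classical
  set s : Set H := q '' Set.Iio n with hs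
  have hsfin : s.Finite := (Set.finite_Iio n).image q
  have : FiniteDimensional ℂ (Submodule.span ℂ s) := FiniteDimensional.span_of_finite ℂ hsfin
  set V := Submodule.span ℂ s with hV
  have hmem : ∀ x, x ∈ Vᗮ ↔ ∀ j < n, ⟪q j, x⟫_ℂ = 0 := fun x => by
    rw [hV, mem_orthogonal_span_iff, hs, Set.forall_mem_image]; rfl
  have hSV : ∀ x ∈ V, S x ∈ V := fun x hx => by
    induction hx using Submodule.span_induction with
    | mem v hv =>
      obtain ⟨i, hi, rfl⟩ := hv
      rw [h.eig i hi]
      exact V.smul_mem _ (Submodule.subset_span ⟨i, hi, rfl⟩)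
    | zero => simp
    | add u v _ _ hu hv => rw [map_add]; exact V.add_mem hu hv
    | smul a v _ hv => rw [map_smul]; exact V.smul_mem _ hv
  have hSV' : ∀ x ∈ Vᗮ, S x ∈ Vᗮ := fun x hx => by
    intro v hv
    rw [← hS.inner_left_eq_inner_right]
    exact hx _ (hSV v hv)
  have hcomm : Commute S V.starProjection := by
    ext x
    refine (Submodule.eq_starProjection_of_mem_orthogonal
      (hSV _ (V.starProjection_apply_mem x)) ?_).symm
    change S x - S (V.starProjection x) ∈ Vᗮ
    rw [← map_sub]
    exact hSV' _ (V.sub_starProjection_mem_orthogonal x)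
  obtain ⟨f, hf0, hfz, hfge⟩ := exists_compactlySupported (essNorm_nonneg S)
  set B := cfc (f : ℝ → ℝ) S with hB
  have hBpos : B.IsPositive :=
    (ContinuousLinearMap.nonneg_iff_isPositive _).1 (cfc_nonneg fun t _ => hf0 t)
  have hBcomm : Commute B V.starProjection := hcomm.cfc_real _
  have hsa : IsSelfAdjoint S := hS.isSelfAdjoint
  -- On the spectrum, `t - ‖S‖ₑ + f t ≥ 0`. A vector with zero `f(S)`-form therefore has `S`-form at
  -- least `‖S‖ₑ * ‖x‖ ^ 2`, which on the complement of `V` is possible only for zero.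
  have hD : (S - algebraMap ℝ (H →L[ℂ] H) (essNorm S) + B).IsPositive := by
    have h1 : cfc (fun t => t - essNorm S + f t) S
        = S - algebraMap ℝ (H →L[ℂ] H) (essNorm S) + B := by
      rw [cfc_add S (fun t => t - essNorm S) (f : ℝ → ℝ) (by fun_prop) f.continuous.continuousOn,
        cfc_sub (fun t => t) (fun _ => essNorm S) S, cfc_id' ℝ S, cfc_const (essNorm S) S]
    rw [← h1, ← ContinuousLinearMap.nonneg_iff_isPositive]
    refine cfc_nonneg fun t ht => ?_
    have ht0 : 0 ≤ t :=
      spectrum_nonneg_of_nonneg ((ContinuousLinearMap.nonneg_iff_isPositive S).2 hS) ht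
    linarith [hfge t ht0]
  have hsub : {x : H | scalarSpectralMeasure S x (Set.Icc (essNorm S) ‖S‖)ᶜ = 0} ⊆ V := by
    intro x hx
    have hxB : (⟪x, B x⟫_ℂ).re = 0 := by
      rw [hB, ← integral_scalarSpectralMeasure]
      refine integral_eq_zero_of_ae ?_
      refine measure_mono_null (fun t ht => ?_) hx
      exact fun ht' => ht (hfz t ht'.1)
    set v := V.starProjection x with hv
    set w := x - v with hw
    have hvV : v ∈ V := V.starProjection_apply_mem x
    have hwV : w ∈ Vᗮ := V.sub_starProjection_mem_orthogonal x
    have hxvw : x = v + w := by rw [hw]; abel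
    -- Since `V` reduces `S`, it reduces `B = f(S)`, so the vanishing `B`-form of `x` splits into
    -- nonnegative parts on `V` and `Vᗮ`.
    have hBv : B v ∈ V := by
      have h1 : B v = V.starProjection (B x) := congrArg (fun A : H →L[ℂ] H => A x) hBcomm.eq
      rw [h1]
      exact V.starProjection_apply_mem _
    have h1 : ⟪w, B v⟫_ℂ = 0 := Submodule.inner_left_of_mem_orthogonal hBv hwV
    have h2 : ⟪v, B w⟫_ℂ = 0 := by
      rw [← hBpos.inner_left_eq_inner_right]
      exact Submodule.inner_right_of_mem_orthogonal hBv hwV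
    have hwB : (⟪w, B w⟫_ℂ).re = 0 := by
      have h3 : (⟪x, B x⟫_ℂ).re = (⟪v, B v⟫_ℂ).re + (⟪w, B w⟫_ℂ).re := by
        rw [hxvw, map_add, inner_add_left, inner_add_right, inner_add_right, h1, h2]
        simp
      have h4 : 0 ≤ (⟪v, B v⟫_ℂ).re := hBpos.re_inner_nonneg_right v
      have h5 : 0 ≤ (⟪w, B w⟫_ℂ).re := hBpos.re_inner_nonneg_right w
      linarith
    have hw0 : w = 0 := by
      by_contra hne
      have h3 := hlt w hne ((hmem w).1 hwV)
      have h4 : 0 ≤ (⟪w, (S - algebraMap ℝ (H →L[ℂ] H) (essNorm S) + B) w⟫_ℂ).re :=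
        hD.re_inner_nonneg_right w
      have h5 : (algebraMap ℝ (H →L[ℂ] H) (essNorm S)) w = ((essNorm S : ℝ) : ℂ) • w := by
        rw [Algebra.algebraMap_eq_smul_one]
        rfl
      have h6 : (⟪w, w⟫_ℂ).re = ‖w‖ ^ 2 := inner_self_eq_norm_sq (𝕜 := ℂ) w
      rw [add_apply, sub_apply, h5, inner_add_right, inner_sub_right, inner_smul_right,
        Complex.add_re, Complex.sub_re, Complex.re_ofReal_mul, h6, hwB] at h4
      linarith
    rw [hxvw, hw0, add_zero]
    exact hvV
  have hclos : Submodule.topologicalClosure (Submodule.span ℂ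
      {x : H | scalarSpectralMeasure S x (Set.Icc (essNorm S) ‖S‖)ᶜ = 0}) ≤ V :=
    Submodule.topologicalClosure_minimal _ (Submodule.span_le.2 hsub)
      (Submodule.closed_of_finiteDimensional V)
  have hrange : LinearMap.range (P2 S : H →ₗ[ℂ] H) ≤ V := by
    rintro _ ⟨x, rfl⟩
    exact hclos (Submodule.starProjection_apply_mem _ x)
  have hspan : V = Submodule.span ℂ (((Finset.range n).image q : Finset H) : Set H) := by
    rw [hV, hs]
    congr 1
    ext
    simp
  calc opRank (P2 S) ≤ Module.rank ℂ V := Submodule.rank_mono hrange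
    _ ≤ ((Finset.range n).image q).card := by rw [hspan]; exact rank_span_finset_le _
    _ ≤ n := by
      exact_mod_cast Finset.card_image_le.trans (Finset.card_range n).le

end

/-! ### Realizing the large norms below `S`, then the small ones. -/

section

theorem sum_le_seqU {c : ℕ → ℝ} (hc : BddAbove (Set.range c)) (F : Finset ℕ) :
    ∑ i ∈ F, c i ≤ seqU F.card c := by
  obtain ⟨M, hM⟩ := hc
  refine le_csSup ⟨F.card * M, ?_⟩ ⟨F, rfl, rfl⟩
  rintro _ ⟨G, hG, rfl⟩
  rw [← hG, ← nsmul_eq_mul]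
  exact Finset.sum_le_card_nsmul _ _ _ fun i _ => hM ⟨i, rfl⟩

/-- A finite set can be enumerated so that a given function decreases. -/
theorem exists_antitone_enumeration (F : Finset ℕ) (c : ℕ → ℝ) :
    ∃ τ : ℕ → ℕ, Set.InjOn τ (Finset.range F.card) ∧ (Finset.range F.card).image τ = F ∧
      ∀ i j, i ≤ j → j < F.card → c (τ j) ≤ c (τ i) := by
  let g : Fin F.card → ℝ := fun i => -c (F.equivFin.symm i)
  let e : Fin F.card ≃ F := (Tuple.sort g).trans F.equivFin.symm
  let τ : ℕ → ℕ := fun i => if h : i < F.card then e ⟨i, h⟩ else 0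
  have hτ : ∀ i (h : i < F.card), τ i = e ⟨i, h⟩ := fun i h => dif_pos h
  have hinj : Set.InjOn τ (Finset.range F.card) := by
    intro i hi j hj hij
    have hi := Finset.mem_range.1 hi
    have hj := Finset.mem_range.1 hj
    rw [hτ i hi, hτ j hj] at hij
    simpa using e.injective (Subtype.ext hij)
  refine ⟨τ, hinj, ?_, fun i j hij hj => ?_⟩
  · refine Finset.eq_of_subset_of_card_le (fun x hx => ?_) ?_
    · obtain ⟨i, hi, rfl⟩ := Finset.mem_image.1 hx
      rw [hτ i (Finset.mem_range.1 hi)]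
      exact (e _).2
    · rw [Finset.card_image_of_injOn hinj, Finset.card_range]
  · rw [hτ j hj, hτ i (by omega)]
    have := Tuple.monotone_sort g (show (⟨i, by omega⟩ : Fin F.card) ≤ ⟨j, hj⟩ from hij)
    exact neg_le_neg_iff.1 this

variable {H : Type*} [NormedAddCommGroup H] [InnerProductSpace ℂ H] [CompleteSpace H]

/-- Given a top flag of `S` of length `n`, finitely many prescribed squared norms can be realized
below `S` if their partial sums are dominated by the eigenvalues, continued by the essential
norm. -/
theorem IsTopFlag.exists_partial {S : H →L[ℂ] H} (hS : S.IsPositive) {n : ℕ} {q : ℕ → H}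
    {l : ℕ → ℝ} (h : IsTopFlag S n q l) (hess : 0 < essNorm S) (N : ℕ) (c : ℕ → ℝ)
    (hc : ∀ i, 0 ≤ c i) (hanti : ∀ i j, i ≤ j → j < N → c j ≤ c i)
    (hle : ∀ k ≤ N, k ≤ n → ∑ i ∈ Finset.range k, c i ≤ ∑ i ∈ Finset.range k, l i)
    (hlt : ∀ k ≤ N, n < k →
      ∑ i ∈ Finset.range k, c i < ∑ i ∈ Finset.range n, l i + (k - n) * essNorm S) :
    ∃ f : ℕ → H, (∀ i < N, ‖f i‖ ^ 2 = c i) ∧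
      ∀ x, ∑ i ∈ Finset.range N, ‖⟪f i, x⟫_ℂ‖ ^ 2 ≤ (⟪x, S x⟫_ℂ).re := by
  -- The form need not reach `‖S‖ₑ` beyond the flag, but the finitely many strict inequalities
  -- survive replacing `‖S‖ₑ` by a slightly smaller `g`.
  obtain ⟨g, ⟨hgpos, hgsum⟩, hgess⟩ : ∃ g, (0 < g ∧ ∀ k ∈ Finset.Ioc n N,
      ∑ i ∈ Finset.range k, c i < ∑ i ∈ Finset.range n, l i + (k - n) * g) ∧ g < essNorm S := by
    have h1 : ∀ᶠ g in 𝓝[<] essNorm S, 0 < g ∧ ∀ k ∈ Finset.Ioc n N,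
        ∑ i ∈ Finset.range k, c i < ∑ i ∈ Finset.range n, l i + (k - n) * g := by
      refine ((lt_mem_nhds hess).filter_mono nhdsWithin_le_nhds).and
        ((Filter.eventually_all_finset _).2 fun k hk => ?_)
      obtain ⟨hk1, hk2⟩ := Finset.mem_Ioc.1 hk
      have hcont : Continuous fun g : ℝ => ∑ i ∈ Finset.range n, l i + (k - n) * g := by fun_prop
      exact (hcont.continuousAt.eventually_const_lt (hlt k hk2 hk1)).filter_mono
        nhdsWithin_le_nhds
    exact (h1.and self_mem_nhdsWithin).exists
  obtain ⟨q', hq', hqq', hgq'⟩ := exists_orthonormal_seq hS hgpos.le hgess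
    ((Set.finite_Iio n).image q)
  let p : ℕ → H := fun i => if i < n then q i else q' (i - n)
  have hp1 : ∀ i < n, p i = q i := fun i hi => if_pos hi
  have hp2 : ∀ i, p (n + i) = q' i := fun i => by simp [p]
  have hp : Orthonormal ℂ p := by
    have hlt' : ∀ i j, i < j → ⟪p i, p j⟫_ℂ = 0 := by
      intro i j hij
      rcases lt_or_ge j n with hj | hj
      · rw [hp1 i (by omega), hp1 j hj, h.orth i j hij hj]
      · obtain ⟨j, rfl⟩ := Nat.exists_eq_add_of_le hj
        rcases lt_or_ge i n with hi | hi
        · rw [hp1 i hi, hp2]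
          exact hqq' j _ ⟨i, hi, rfl⟩
        · obtain ⟨i, rfl⟩ := Nat.exists_eq_add_of_le hi
          rw [hp2, hp2]
          exact hq'.2 (by omega)
    refine ⟨fun i => ?_, fun i j hij => ?_⟩
    · rcases lt_or_ge i n with hi | hi
      · rw [hp1 i hi, h.norm i hi]
      · obtain ⟨i, rfl⟩ := Nat.exists_eq_add_of_le hi
        rw [hp2, hq'.1]
    · rcases lt_or_gt_of_ne hij with hij | hij
      · exact hlt' i j hij
      · rw [← inner_conj_symm, hlt' j i hij, map_zero]
  obtain ⟨R, hsymm, -, hR⟩ := exists_sqrt hS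
  have hsum1 : ∀ k ≤ n, ∑ i ∈ Finset.range k, ‖R (p i)‖ ^ 2 = ∑ i ∈ Finset.range k, l i :=
    fun k hk => Finset.sum_congr rfl fun i hi => by
      have hi := Finset.mem_range.1 hi
      rw [hR, hp1 i (by omega), h.re_inner (by omega)]
  obtain ⟨f, hf, hfx⟩ := exists_of_partial_sums_le N c (fun i => R (p i)) hc hanti (by
    intro k hk
    rcases le_or_gt k n with hkn | hkn
    · rw [hsum1 k hkn]
      exact hle k hk hkn
    · refine (hgsum k (Finset.mem_Ioc.2 ⟨hkn, hk⟩)).le.trans ?_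
      obtain ⟨j, rfl⟩ := Nat.exists_eq_add_of_le hkn.le
      rw [Finset.sum_range_add, hsum1 n le_rfl]
      refine add_le_add le_rfl ?_
      have h1 : ∑ i ∈ Finset.range j, g ≤ ∑ i ∈ Finset.range j, ‖R (p (n + i))‖ ^ 2 :=
        Finset.sum_le_sum fun i _ => by rw [hR, hp2]; exact (hgq' i).le
      simpa using h1)
  refine ⟨f, hf, fun x => (hfx x).trans ?_⟩
  simp only [hsymm]
  rw [← hR]
  -- With `h i = R (p i)`, Bessel's inequality for the orthonormal `p` at `R x` gives `∑ h i ⊗ h i ≤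
  -- S`.
  exact hp.sum_inner_products_le (R x)

/-- Finitely many large squared norms that are realized below `S` leave enough room for the
remaining small ones. -/
theorem exists_decomposition_of_partial [TopologicalSpace.SeparableSpace H] {S : H →L[ℂ] H}
    (hS : S.IsPositive) {c : ℕ → ℝ} (hc : ∀ i, 0 ≤ c i)
    (hsum : Tendsto (fun n => ∑ i ∈ Finset.range n, c i) atTop atTop) {b : ℝ} (hb : 0 ≤ b)
    (hbess : b < essNorm S) (F : Finset ℕ) (hF : ∀ i ∉ F, c i ≤ b) (f₁ : ℕ → H)
    (hf₁ : ∀ i ∈ F, ‖f₁ i‖ ^ 2 = c i) (hf₁' : ∀ i ∉ F, f₁ i = 0)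
    (hf₁S : ∀ x, ∑ i ∈ F, ‖⟪f₁ i, x⟫_ℂ‖ ^ 2 ≤ (⟪x, S x⟫_ℂ).re) :
    ∃ f : ℕ → H, (∀ i, ‖f i‖ ^ 2 = c i) ∧
      ∀ x, HasSum (fun i => ‖⟪f i, x⟫_ℂ‖ ^ 2) (⟪x, S x⟫_ℂ).re := by
  have hT := isPositive_subRankOnes hS f₁ F hf₁S
  obtain ⟨g, hbg, hgess⟩ := exists_between hbess
  obtain ⟨q, hq, hqo, hqg⟩ := exists_orthonormal_seq hS (hb.trans hbg.le) hgess
    (F.finite_toSet.image f₁)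
  -- The `q n` are orthogonal to the removed vectors, so the form at `q n` is unchanged.
  have hqT : ∀ n, g ≤ (⟪q n, subRankOnes S f₁ F (q n)⟫_ℂ).re := fun n => by
    rw [re_inner_subRankOnes, Finset.sum_eq_zero fun k hk => by
      rw [hqo n _ ⟨k, hk, rfl⟩, norm_zero, zero_pow two_ne_zero], sub_zero]
    exact (hqg n).le
  -- Norm zero is prescribed on `F`, so the two families have disjoint supports and can simply be
  -- added.
  let c₀ : ℕ → ℝ := fun i => if i ∈ F then 0 else c i
  have hc₀in : ∀ i ∈ F, c₀ i = 0 := fun i hi => if_pos hi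
  have hc₀out : ∀ i ∉ F, c₀ i = c i := fun i hi => if_neg hi
  have hc₀sum : Tendsto (fun n => ∑ i ∈ Finset.range n, c₀ i) atTop atTop := by
    refine tendsto_atTop_mono (fun n => ?_)
      (tendsto_atTop_add_const_right atTop (-∑ i ∈ F, c i) hsum)
    have h1 : ∑ i ∈ Finset.range n, c i
        = ∑ i ∈ Finset.range n, c₀ i + ∑ i ∈ Finset.range n with i ∈ F, c i := by
      rw [Finset.sum_filter, ← Finset.sum_add_distrib]
      refine Finset.sum_congr rfl fun i _ => ?_
      by_cases hi : i ∈ F <;> simp [c₀, hi]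
    have h2 : ∑ i ∈ Finset.range n with i ∈ F, c i ≤ ∑ i ∈ F, c i :=
      Finset.sum_le_sum_of_subset_of_nonneg (fun i hi => (Finset.mem_filter.1 hi).2)
        fun i _ _ => hc i
    linarith
  obtain ⟨f₀, hf₀, hf₀x⟩ := exists_decomposition hT hbg hq hqT c₀
    (fun i => by by_cases hi : i ∈ F <;> simp [c₀, hi, hc i])
    (fun i => by
      by_cases hi : i ∈ F
      · rw [hc₀in i hi]; exact hb
      · rw [hc₀out i hi]; exact hF i hi) hc₀sum
  have hf₀in : ∀ i ∈ F, f₀ i = 0 := fun i hi => by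
    have := hf₀ i
    rw [hc₀in i hi] at this
    exact norm_eq_zero.1 (pow_eq_zero_iff two_ne_zero |>.1 this)
  refine ⟨fun i => f₀ i + f₁ i, fun i => ?_, fun x => ?_⟩
  · beta_reduce
    by_cases hi : i ∈ F
    · rw [hf₀in i hi, zero_add, hf₁ i hi]
    · rw [hf₁' i hi, add_zero, hf₀ i, hc₀out i hi]
  · have h1 : HasSum (fun i => ‖⟪f₁ i, x⟫_ℂ‖ ^ 2) (∑ i ∈ F, ‖⟪f₁ i, x⟫_ℂ‖ ^ 2) :=
      hasSum_sum_of_ne_finset_zero fun i hi => by simp [hf₁' i hi]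
    have h2 := (hf₀x x).add h1
    rw [re_inner_subRankOnes, sub_add_cancel] at h2
    convert h2 using 2 with i
    by_cases hi : i ∈ F
    · simp [hf₀in i hi]
    · simp [hf₁' i hi]

end

end FrameAdm

/-! ### Assembly of the main theorem. -/

theorem theorem5p4 {H : Type*} [NormedAddCommGroup H] [InnerProductSpace ℂ H] [CompleteSpace H]
    [TopologicalSpace.SeparableSpace H] (hH : ¬ FiniteDimensional ℂ H)
    (S : H →L[ℂ] H) (hpos : S.IsPositive) (hinv : IsUnit S)
    (c : ℕ → ℝ) (hc : ∀ i, 0 ≤ c i) (hbdd : BddAbove (Set.range c))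
    (hsum : Tendsto (fun n => ∑ i ∈ Finset.range n, c i) atTop atTop)
    (hcond :
      (Cardinal.aleph0 ≤ FrameAdm.opRank (FrameAdm.P2 S) ∧
        (∀ k : ℕ, 1 ≤ k → FrameAdm.seqU k c ≤ FrameAdm.opU k S) ∧
        limsup c atTop < FrameAdm.essNorm S) ∨
      (∃ r : ℕ, FrameAdm.opRank (FrameAdm.P2 S) = (r : Cardinal) ∧
        (∀ k : ℕ, 1 ≤ k → k ≤ r → FrameAdm.seqU k c ≤ FrameAdm.opU k S) ∧
        (∀ k : ℕ, r < k → FrameAdm.seqU k c < FrameAdm.opU k S) ∧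
        limsup c atTop < FrameAdm.essNorm S)) :
    FrameAdm.FrameAdmissible S c := by
  open FrameAdm in
  classical
  have hlim : limsup c atTop < essNorm S := by
    rcases hcond with ⟨-, -, h⟩ | ⟨r, -, -, -, h⟩ <;> exact h
  have hle : ∀ k : ℕ, 1 ≤ k → seqU k c ≤ opU k S := by
    rcases hcond with ⟨-, h, -⟩ | ⟨r, -, h1, h2, -⟩
    · exact h
    · intro k hk
      rcases le_or_gt k r with hkr | hkr
      · exact h1 k hk hkr
      · exact (h2 k hkr).le
  obtain ⟨b, hcb, hbess⟩ := exists_between hlim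
  have hev : ∀ᶠ i in atTop, c i < b := eventually_lt_of_limsup_lt hcb hbdd.isBoundedUnder_of_range
  have hb : 0 < b := by
    obtain ⟨i, hi⟩ := hev.exists
    exact (hc i).trans_lt hi
  have hfin : {i | ¬ c i < b}.Finite := by
    rw [← Nat.cofinite_eq_atTop] at hev
    exact hev
  set F := hfin.toFinset with hFdef
  have hF : ∀ i ∉ F, c i ≤ b := fun i hi => by
    rw [hFdef, Set.Finite.mem_toFinset] at hi
    exact (not_not.1 hi).le
  obtain ⟨τ, hτinj, hτF, hτc⟩ := exists_antitone_enumeration F c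
  have hτsum : ∀ k ≤ F.card, ∑ i ∈ Finset.range k, c (τ i) ≤ seqU k c := by
    intro k hk
    have hinj : Set.InjOn τ (Finset.range k) :=
      hτinj.mono (Finset.coe_subset.2 (Finset.range_mono hk))
    have h1 := sum_le_seqU hbdd ((Finset.range k).image τ)
    rwa [Finset.sum_image hinj, Finset.card_image_of_injOn hinj, Finset.card_range] at h1
  obtain ⟨n, q, l, -, hflag, hbelow⟩ := exists_isTopFlag hpos F.card
  obtain ⟨f', hf', hf'x⟩ := hflag.exists_partial hpos (hb.trans hbess) F.card (fun i => c (τ i))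
    (fun i => hc _) hτc
    (fun k hk hkn => by
      rcases Nat.eq_zero_or_pos k with rfl | hk0
      · simp
      · exact (hτsum k hk).trans ((hle k hk0).trans (hflag.opU_le_sum hpos hk0 hkn)))
    (fun k hk hkn => by
      rcases hbelow with rfl | hbelow
      · omega
      -- A flag that stops early forces `P₂(S)` to have rank at most `n`; this excludes the first
      -- condition and makes the strict inequalities of the second available for every `k > n`.
      · have hrank := hflag.opRank_P2_le hpos hbelow
        rcases hcond with ⟨h, -, -⟩ | ⟨r, hr, -, h, -⟩
        · exact absurd (h.trans hrank) (not_le.2 Cardinal.natCast_lt_aleph0)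
        · have hrn : r ≤ n := by
            rw [hr] at hrank
            exact_mod_cast hrank
          refine (hτsum k hk).trans_lt ((h k (by omega)).trans_le
            (hflag.opU_le hpos (essNorm_nonneg S) (fun i hi => hflag.essNorm_le hpos hi)
              (fun x hx => ?_) hkn.le))
          rcases eq_or_ne x 0 with rfl | hx0
          · simp
          · exact (hbelow x hx0 hx).le)
  let f₁ : ℕ → H := fun i => if i ∈ F then f' (Function.invFunOn τ (Finset.range F.card) i) else 0
  have hτmem : ∀ i < F.card, τ i ∈ F := fun i hi =>
    hτF.subset (Finset.mem_image_of_mem _ (Finset.mem_range.2 hi))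
  have hf₁τ : ∀ i < F.card, f₁ (τ i) = f' i := fun i hi => by
    have hi' : i ∈ (Finset.range F.card : Set ℕ) := Finset.mem_coe.2 (Finset.mem_range.2 hi)
    simp only [f₁, if_pos (hτmem i hi)]
    rw [hτinj.leftInvOn_invFunOn hi']
  obtain ⟨f, hf, hfx⟩ := exists_decomposition_of_partial hpos hc hsum hb.le hbess F hF f₁
    (fun i hi => by
      rw [← hτF] at hi
      obtain ⟨j, hj, rfl⟩ := Finset.mem_image.1 hi
      rw [hf₁τ j (Finset.mem_range.1 hj), hf' j (Finset.mem_range.1 hj)])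
    (fun i hi => if_neg hi)
    (fun x => by
      have h1 : ∑ i ∈ F, ‖⟪f₁ i, x⟫_ℂ‖ ^ 2
          = ∑ i ∈ Finset.range F.card, ‖⟪f' i, x⟫_ℂ‖ ^ 2 := by
        conv_lhs => rw [← hτF]
        rw [Finset.sum_image hτinj]
        exact Finset.sum_congr rfl fun i hi => by rw [hf₁τ i (Finset.mem_range.1 hi)]
      rw [h1]
      exact hf'x x)
  exact frameAdmissible_of_hasSum hpos hinv f hf hfx
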